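/- Let $X\in\mathbb{R}^{p_1\times\cdots\times p_K}$ denote a real $K$-way array, and for a list of matrices $A=(A_1,\dots,A_K)$, $A_k\in\mathbb{R}^{p_k\times p_k}$, let $(A\cdot X)_{[i_1,\dots,i_K]}=\sum_{j_1,\dots,j_K}\bigl(\prod_k (A_k)_{[i_k,j_k]}\bigr)X_{[j_1,\dots,j_K]}$. For every $X$ fix a higher-order SVD: for each mode $k$ an orthogonal matrix $U_k$ and numbers $\sigma^k_1\ge\dots\ge\sigma^k_{p_k}\ge 0$ (the mode-$k$ singular values) with $X_{(k)}X_{(k)}^T=U_kD_k^2U_k^T$, where $X_{(k)}$ is the mode-$k$ unfolding of $X$ and $D_k=\mathrm{diag}(\sigma^k_1,\dots,\sigma^k_{p_k})$. Put $s_k=(\sigma^k_1,\dots,\sigma^k_{p_k})$, $D=(D_1,\dots,D_K)$, $U=(U_1,\dots,U_K)$, and $\mathcal S=U^T\cdot X$ (the core array). Let $R$ be the set of arrays $X$ such that, in every mode $k$, the numbers $\sigma^k_1,\dots,\sigma^k_{p_k}$ are positive and pairwise distinct. For each $k$ let $g^k:[0,\infty)^{p_k}\to\mathbb{R}^{p_k}$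 (in particular, $g^k$ may have nonnegative values), $f^k(D_k)=\mathrm{diag}(g^k(s_k))$, $f(D)=(f^1(D_1),\dots,f^K(D_K))$, and consider the estimator $$t(X)=U\cdot f(D)\cdot D^{-1}\cdot\mathcal S .$$ Let $\mathcal S^2$ be the entrywise square of $\mathcal S$, let $\mathrm{sum}$ denote the sum of all entries of an array, and let $\mathcal C$ be the array $$\mathcal C_{[\mathbf i]}=1+\sum_{k=1}^K\sum_{j\ne i_k}\frac{\mathcal S_{[i_1,\dots,i_{k-1},j,i_{k+1},\dots,i_K]}^2}{(\sigma^k_{i_k})^2-(\sigma^k_j)^2}-\mathcal S_{[\mathbf i]}^2\sum_{k=1}^K\Bigl(\frac1{(\sigma^k_{i_k})^2}+\sum_{m\neq i_k}\frac1{(\sigma^k_m)^2-(\sigma^k_{i_k})^2}\Bigr).$$ Given matrices $J_{g^k}(s_k)\in\mathbb{R}^{p_k\times p_k}$, let $$Q_k=\bigl(f^1(D_1)D_1^{-1},\dots,f^{k-1}(D_{k-1})D_{k-1}^{-1},\ J^k(D_k)D_k^{-2},\ f^{k+1}(D_{k+1})D_{k+1}^{-1},\dots,f^K(D_K)D_K^{-1}\bigr),$$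 $$J^k(D_k)=\mathrm{diag}\bigl(J_{g^k}(s_k)_{[1,1]},\dots,J_{g^k}(s_k)_{[p_k,p_k]}\bigr).$$ **(i) Pointwise form.** If $X\in R$ and every $g^k$ is differentiable at $s_k=s_k(X)$, with Jacobian matrix $J_{g^k}(s_k)$, then $t$ is differentiable at $X$ and $$\mathrm{div}\,t(X)=\sum_{\mathbf i}\frac{\partial t_{[\mathbf i]}}{\partial X_{[\mathbf i]}}(X)=\mathrm{sum}\Bigl(f(D)\cdot D^{-1}\cdot\mathcal C+\sum_{k=1}^KQ_k\cdot\mathcal S^2\Bigr).$$ **(ii) Weak form.** Suppose every $g^k$ is weakly differentiable on $(0,\infty)^{p_k}$ with weak Jacobian $J_{g^k}$ (both with locally integrable entries), and suppose that for all $\mathbf i$, $k$ and $b$ the functions $X\mapsto\prod_{l}g^l_{i_l}(s_l)$ and $X\mapsto J_{g^k}(s_k)_{[i_k,b]}\prod_{l\ne k}g^l_{i_l}(s_l)$ are locally integrable on $R$. Then $t$ is weakly differentiable on $R$ (test functions being smooth with compact support in $R$), and its weak divergence, the trace of its weak Jacobian, equals $\mathrm{sum}\bigl(f(D)\cdot D^{-1}\cdot\mathcal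 C+\sum_kQ_k\cdot\mathcal S^2\bigr)$ for almost every $X\in R$. In both cases only the diagonal entries $J_{g^k}(s_k)_{[i_k,i_k]}$ of the Jacobians enter the formula, through $J^k(D_k)$. -/

import Mathlib

open MeasureTheory
open scoped ContDiff

noncomputable section

namespace HOSpectral

/-- Real `K`-way arrays of size `p 0 × ⋯ × p (K-1)`. -/
abbrev Tensor {K : ℕ} (p : Fin K → ℕ) : Type := (∀ k, Fin (p k)) → ℝ

/-- A list of `K` square matrices, one per mode. -/
abbrev ModeMatrices {K : ℕ} (p : Fin K → ℕ) : Type :=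
  ∀ k, Matrix (Fin (p k)) (Fin (p k)) ℝ

variable {K : ℕ} {p : Fin K → ℕ}

/-- The multilinear (Tucker) product `(A₁, …, A_K) · X`. -/
def tucker (A : ModeMatrices p) (X : Tensor p) : Tensor p :=
  fun i => ∑ j, (∏ k, A k (i k) (j k)) * X j

/-- The mode-`k` unfolding of `X`: rows are indexed by the `k`-th index, columns by the
tuple of all other indices. -/
def unfold (k : Fin K) (X : Tensor p) :
    Matrix (Fin (p k)) (∀ l : {l : Fin K // l ≠ k}, Fin (p l)) ℝ :=
  fun a r => X ((Equiv.piSplitAt k (fun l => Fin (p l))).symm (a, r))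

/-- A higher-order singular value decomposition of `X`: for each mode `k`, an orthogonal matrix
`U k` of left singular vectors of the mode-`k` unfolding, and the corresponding mode-specific
singular values `σ k` in decreasing order, so that `X₍ₖ₎ X₍ₖ₎ᵀ = Uₖ Dₖ² Uₖᵀ`. -/
structure HOSVD (X : Tensor p) where
  U : ModeMatrices p
  σ : ∀ k, Fin (p k) → ℝ
  orthogonal : ∀ k, U k ∈ Matrix.orthogonalGroup (Fin (p k)) ℝ
  nonneg : ∀ k a, 0 ≤ σ k a
  antitone : ∀ k, Antitone (σ k)
  gram : ∀ k, unfold k X * (unfold k X).transpose =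
    U k * Matrix.diagonal (σ k) ^ 2 * (U k).transpose

/-- Every array has a higher-order singular value decomposition. -/
instance HOSVD.instNonempty (X : Tensor p) : Nonempty (HOSVD X) := by
  classical
  have hA : ∀ k, (unfold k X * (unfold k X).transpose).PosSemidef := fun k => by
    simpa using Matrix.posSemidef_self_mul_conjTranspose (unfold k X)
  let e : ∀ k, Fin (p k) ≃ Fin (p k) := fun k =>
    (finCongr (Fintype.card_fin (p k)).symm).trans
      (Fintype.equivOfCardEq (Fintype.card_fin (Fintype.card (Fin (p k)))))
  have hUU : ∀ k, ((hA k).1.eigenvectorUnitary : Matrix (Fin (p k)) (Fin (p k)) ℝ) *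
      ((hA k).1.eigenvectorUnitary : Matrix (Fin (p k)) (Fin (p k)) ℝ).transpose = 1 := fun k => by
    have h := Matrix.mem_unitaryGroup_iff.1 (hA k).1.eigenvectorUnitary.2
    rwa [Matrix.star_eq_conjTranspose, Matrix.conjTranspose_eq_transpose_of_trivial] at h
  refine ⟨⟨fun k => ((hA k).1.eigenvectorUnitary : Matrix _ _ ℝ).submatrix id (e k),
    fun k a => √((hA k).1.eigenvalues (e k a)), fun k => ?_, fun k a => Real.sqrt_nonneg _,
    fun k a b hab => ?_, fun k => ?_⟩⟩
  · rw [Matrix.mem_orthogonalGroup_iff, Matrix.transpose_submatrix,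
      Matrix.submatrix_mul_equiv, hUU k, Matrix.submatrix_id_id]
  · refine Real.sqrt_le_sqrt ?_
    simp only [Matrix.IsHermitian.eigenvalues, e, Equiv.trans_apply, Equiv.symm_apply_apply]
    exact (hA k).1.eigenvalues₀_antitone (by simpa using hab)
  · have hD : Matrix.diagonal (fun a => √((hA k).1.eigenvalues (e k a))) ^ 2 =
        (Matrix.diagonal (hA k).1.eigenvalues).submatrix (e k) (e k) := by
      rw [Matrix.diagonal_pow, Matrix.submatrix_diagonal_equiv]
      congr 1
      funext a
      exact Real.sq_sqrt ((hA k).eigenvalues_nonneg _)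
    rw [hD, Matrix.transpose_submatrix, Matrix.submatrix_mul_equiv, Matrix.submatrix_mul_equiv,
      Matrix.submatrix_id_id]
    have h := (hA k).1.spectral_theorem
    rw [Unitary.conjStarAlgAut_apply, Matrix.star_eq_conjTranspose,
      Matrix.conjTranspose_eq_transpose_of_trivial] at h
    simpa [Function.comp_def] using h

namespace HOSVD

variable {X : Tensor p}

/-- The diagonal matrices `D = (D₁, …, D_K)` of mode-specific singular values. -/
def D (h : HOSVD X) : ModeMatrices p := fun k => Matrix.diagonal (h.σ k)

/-- The core array `S = Uᵀ · X`. -/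
def S (h : HOSVD X) : Tensor p := tucker (fun k => (h.U k).transpose) X

/-- In every mode the singular values are positive and pairwise distinct. -/
def Regular (h : HOSVD X) : Prop := ∀ k, (∀ a, 0 < h.σ k a) ∧ Function.Injective (h.σ k)

/-- The spectral functions `f(D) = (f¹(D₁), …, f^K(D_K))`, `fᵏ(Dₖ) = diag(gᵏ(sₖ))`. -/
def f (h : HOSVD X) (g : ∀ k, (Fin (p k) → ℝ) → (Fin (p k) → ℝ)) : ModeMatrices p :=
  fun k => Matrix.diagonal (g k (h.σ k))

/-- The array `C` of the divergence formula. -/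
def C (h : HOSVD X) : Tensor p := fun i =>
  1 + (∑ k, ∑ j ∈ Finset.univ.erase (i k),
        h.S (Function.update i k j) ^ 2 / (h.σ k (i k) ^ 2 - h.σ k j ^ 2))
    - h.S i ^ 2 * ∑ k, (1 / h.σ k (i k) ^ 2 +
        ∑ m ∈ Finset.univ.erase (i k), 1 / (h.σ k m ^ 2 - h.σ k (i k) ^ 2))

/-- The list `Qₖ`: it has `fˡ(D_l) D_l⁻¹` in the modes `l ≠ k` and `Jᵏ(Dₖ) Dₖ⁻²` in mode `k`, where
`Jᵏ(Dₖ)` is the diagonal part of the Jacobian matrix `J k`. -/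
def Q (h : HOSVD X) (g : ∀ k, (Fin (p k) → ℝ) → (Fin (p k) → ℝ)) (J : ModeMatrices p)
    (k : Fin K) : ModeMatrices p :=
  Function.update (fun l => h.f g l * (h.D l)⁻¹) k
    (Matrix.diagonal (J k).diag * ((h.D k)⁻¹) ^ 2)

/-- `sum(f(D) · D⁻¹ · C + ∑ₖ Qₖ · S²)`, where `S²` is the entrywise square and `sum` adds up all
entries. -/
def divergenceFormula (h : HOSVD X) (g : ∀ k, (Fin (p k) → ℝ) → (Fin (p k) → ℝ))
    (J : ModeMatrices p) : ℝ :=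
  ∑ i, (tucker (h.f g) (tucker (fun k => (h.D k)⁻¹) h.C)
    + ∑ k, tucker (h.Q g J k) (fun j => h.S j ^ 2)) i

end HOSVD

/-- The higher-order spectral estimator `t(X) = U · f(D) · D⁻¹ · S`, computed from a choice of a
higher-order singular value decomposition of every array. -/
def estimator (H : ∀ X : Tensor p, HOSVD X) (g : ∀ k, (Fin (p k) → ℝ) → (Fin (p k) → ℝ)) :
    Tensor p → Tensor p :=
  fun X => tucker (H X).U (tucker ((H X).f g) (tucker (fun k => ((H X).D k)⁻¹) (H X).S))

/-- The Jacobian matrix of a map `ℝ^ι → ℝ^ι` at a point. -/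
def jacobian {ι : Type*} [Fintype ι] [DecidableEq ι] (u : (ι → ℝ) → (ι → ℝ)) (x : ι → ℝ) :
    Matrix ι ι ℝ :=
  Matrix.of fun i j => fderiv ℝ u x (Pi.single j 1) i

/-- The divergence `∑ᵢ ∂uᵢ/∂xᵢ` of a vector field at a point. -/
def divergence {ι : Type*} [Fintype ι] [DecidableEq ι] (u : (ι → ℝ) → (ι → ℝ)) (x : ι → ℝ) : ℝ :=
  (jacobian u x).trace

/-- `u` is weakly differentiable on the open set `Ω`, with weak Jacobian matrix `J`: the entries of
`u` and `J` are locally integrable on `Ω`, and integration by parts holds against all smooth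
functions with compact support in `Ω`. -/
structure HasWeakJacobianOn {ι : Type*} [Fintype ι] [DecidableEq ι]
    (u : (ι → ℝ) → (ι → ℝ)) (J : (ι → ℝ) → Matrix ι ι ℝ) (Ω : Set (ι → ℝ)) : Prop where
  locallyIntegrable : ∀ i, LocallyIntegrableOn (fun x => u x i) Ω volume
  locallyIntegrable_jacobian : ∀ i j, LocallyIntegrableOn (fun x => J x i j) Ω volume
  integral_eq : ∀ i j, ∀ φ : (ι → ℝ) → ℝ, ContDiff ℝ ∞ φ → HasCompactSupport φ →
    tsupport φ ⊆ Ω →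
    ∫ x, u x i * fderiv ℝ φ x (Pi.single j 1) = - ∫ x, J x i j * φ x

end HOSpectral

end

/-! On the regular set `R`, t(X) = (W_1,…,W_K)·X with W_k = U_k diag(g^k(s_k)/s_k) U_kᵀ. The chosen
singular vectors may change sign erratically with X, but W_k involves only the singular values and
the entries U_{ia}U_{ja} of the spectral projectors. Both are C¹ on `R`, where the mode Gram
matrices M_k have simple spectrum: ordered eigenvalues by the implicit function theorem for the
characteristic polynomial (`contDiffAt_ordered_eigenvalues`), projectors because they equal adj(λ_a
− M_k)/∏_{b≠a}(λ_a − λ_b) (`mul_eq_adjugate_div`).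

Pointwise form. The divergence is a trace, so it may be computed in the orthonormal basis U·e_i
(`divergence_eq_sum_conj`). Along X + rU·e_i, the matrices W_k and M_k commute; differentiating this
in the frame U_k gives W'_{bc} = (w_b − w_c)/(λ_b − λ_c) M'_{bc} off the diagonal
(`conj_deriv_commute`). Projectors being idempotent, their derivatives have zero diagonal in the
frame, so the diagonal of W' is the derivative of the weights w (`exists_conj_deriv`). To first
order U·e_i moves only the i_k-th singular value of mode k, so only diagonal Jacobian entries
survive (`fderiv_weight`). Splitting the divided differences and exchanging i with its modification
in mode k yields the array C (`divergence_estimator`).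

Weak form. t_i is a finite sum of products ∏ g^k_{a_k}(s_k) with C¹ coefficients
(`estimator_eq_sum`); the coefficients are absorbed into the test function. What remains is a weak
chain and product rule for weakly differentiable functions composed with the maps s_k
(`integral_weak_prod_comp_mul_fderiv`). Each s_k is a C¹ submersion on `R`, so it carries volume on
compact sets to measures of bounded density, and L¹ and almost everywhere approximation by
mollification can be pulled back. Bounded truncation makes the limit of the products legitimate; the
local integrability hypotheses then remove the truncation. The weak Jacobian at X is the classical
Jacobian of the estimator with each g^k replaced by its first order expansion at s_k(X), so its
trace is given by the pointwise form (`trace_weakJacobian`). -/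

open MeasureTheory
open scoped ContDiff

noncomputable section

namespace HOSpectral

open Filter Set
open scoped Topology ENNReal NNReal

/-! ### Volume and submersions -/

section Pushforward

variable {E F : Type*} [NormedAddCommGroup E] [NormedSpace ℝ E] [FiniteDimensional ℝ E]
  [MeasurableSpace E] [BorelSpace E] [NormedAddCommGroup F] [NormedSpace ℝ F]
  [FiniteDimensional ℝ F] [MeasurableSpace F] [BorelSpace F]
  (μ : Measure E) [μ.IsAddHaarMeasure] (ν : Measure F) [ν.IsAddHaarMeasure]

/-- Near a point where it is a submersion, a map of class `C¹` has preimages of volume controlled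
by the volume of the target set. -/
theorem exists_measure_inter_preimage_le {s : E → F} {s' : E →L[ℝ] F} {x₀ : E}
    (hs : HasStrictFDerivAt s s' x₀) (hsurj : Function.Surjective s') :
    ∃ U ∈ 𝓝 x₀, ∃ M : ℝ≥0∞, M ≠ ⊤ ∧
      ∀ A : Set F, MeasurableSet A → μ (U ∩ s ⁻¹' A) ≤ M * ν A := by
  obtain ⟨v₀, hv₀⟩ := (s' : E →ₗ[ℝ] F).exists_rightInverse_of_surjective
    (LinearMap.range_eq_top.2 hsurj)
  set v : F →L[ℝ] E := LinearMap.toContinuousLinearMap v₀ with hv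
  have hsv : s'.comp v = ContinuousLinearMap.id ℝ F := by
    ext y; exact LinearMap.congr_fun hv₀ y
  have hdet : ((1 / 2 : ℝ≥0) : ℝ≥0∞) < ENNReal.ofReal |(ContinuousLinearMap.id ℝ F).det| := by
    have : (ContinuousLinearMap.id ℝ F).det = 1 := LinearMap.det_id
    rw [this, abs_one, ENNReal.ofReal_one]
    exact_mod_cast (by norm_num : (1 / 2 : ℝ≥0) < 1)
  obtain ⟨δ, hδ, hδ0⟩ := ((mul_le_addHaar_image_of_lt_det ν _ hdet).and
    self_mem_nhdsWithin).exists
  have hδ0 : (0 : ℝ≥0) < δ := hδ0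
  -- Composing with `v` multiplies the approximation error by at most `‖v‖`; this constant makes τ ↦
  -- s(x + vτ) `δ`-close to the identity, so it shrinks volume by a factor of at least 1/2.
  obtain ⟨W, hW, hsW⟩ := hs.approximates_deriv_on_nhds (c := δ / (‖v‖₊ + 1))
    (Or.inr (by positivity))
  obtain ⟨ρ, hρ, hρW⟩ := Metric.mem_nhds_iff.1 hW
  have happ := hsW.mono_set hρW
  set B := Metric.ball x₀ ρ
  set T := Metric.ball (0 : F) 1
  have hT0 : ν T ≠ 0 := (Metric.measure_ball_pos ν _ one_pos).ne'
  have hTt : ν T ≠ ⊤ := measure_ball_lt_top.ne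
  refine ⟨B, Metric.ball_mem_nhds _ hρ, (ν T)⁻¹ * (2 * μ (Metric.ball x₀ (ρ + ‖v‖))),
    ENNReal.mul_ne_top (ENNReal.inv_ne_top.2 hT0)
      (ENNReal.mul_ne_top (by simp) measure_ball_lt_top.ne), fun A hA => ?_⟩
  set N := B ∩ s ⁻¹' A with hN
  have hNm : MeasurableSet N := by
    have h := Metric.isOpen_ball.measurableSet.subtype_image
      ((continuousOn_iff_continuous_domRestrict.1 happ.continuousOn).measurable hA)
    rw [domRestrict_eq, preimage_comp, Subtype.image_preimage_coe] at h
    exact h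
  -- Each slice of `N` parallel to the range of `v` is mapped into `A` with volume at least halved,
  -- hence has volume at most 2ν(A); slices through points far from `x₀` are empty.
  have hsmall : ∀ x, ν (T ∩ {τ | x + v τ ∈ N}) ≤ (Metric.ball x₀ (ρ + ‖v‖)).indicator
      (fun _ => 2 * ν A) x := by
    intro x
    by_cases hx : x ∈ Metric.ball x₀ (ρ + ‖v‖)
    · rw [indicator_of_mem hx]
      have h1 : ApproximatesLinearOn (fun τ => s (x + v τ)) (ContinuousLinearMap.id ℝ F)
          (T ∩ {τ | x + v τ ∈ N}) δ := by
        intro a ha b hb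
        have h := happ _ ha.2.1 _ hb.2.1
        have e : x + v a - (x + v b) = v (a - b) := by rw [map_sub]; abel
        have e2 : s' (v (a - b)) = a - b := by
          have := congrArg (fun L : F →L[ℝ] F => L (a - b)) hsv
          simpa using this
        rw [e, e2] at h
        refine h.trans ?_
        have h3 : ‖v (a - b)‖ ≤ ‖v‖ * ‖a - b‖ := v.le_opNorm _
        calc ((δ / (‖v‖₊ + 1) : ℝ≥0) : ℝ) * ‖v (a - b)‖
            ≤ (δ / (‖v‖ + 1)) * (‖v‖ * ‖a - b‖) := by
              push_cast; gcongr
          _ = δ * (‖v‖ / (‖v‖ + 1)) * ‖a - b‖ := by ring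
          _ ≤ δ * 1 * ‖a - b‖ := by
              gcongr; rw [div_le_one (by positivity)]; linarith
          _ = _ := by ring
      have h2 := hδ _ _ h1
      have h3 : ν ((fun τ => s (x + v τ)) '' (T ∩ {τ | x + v τ ∈ N})) ≤ ν A := by
        refine measure_mono ?_
        rintro _ ⟨τ, hτ, rfl⟩
        exact hτ.2.2
      have h4 := h2.trans h3
      calc ν (T ∩ {τ | x + v τ ∈ N})
          = 2 * (((1 / 2 : ℝ≥0) : ℝ≥0∞) * ν (T ∩ {τ | x + v τ ∈ N})) := by
            rw [← mul_assoc]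
            have : (2 : ℝ≥0∞) * ((1 / 2 : ℝ≥0) : ℝ≥0∞) = 1 := by
              have : (2 : ℝ≥0∞) = ((2 : ℝ≥0) : ℝ≥0∞) := rfl
              rw [this, ← ENNReal.coe_mul]; norm_num
            rw [this, one_mul]
        _ ≤ _ := by gcongr
    · rw [indicator_of_notMem hx]
      have : T ∩ {τ | x + v τ ∈ N} = ∅ := by
        ext τ
        simp only [mem_inter_iff, mem_ofPred_eq, mem_empty_iff_false, iff_false, not_and]
        intro hτ hxN
        apply hx
        have h1 : dist (x + v τ) x₀ < ρ := hxN.1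
        have h2 : ‖v τ‖ ≤ ‖v‖ := by
          have := v.le_opNorm τ
          have h3 : ‖τ‖ < 1 := by simpa [T] using hτ
          nlinarith [norm_nonneg v]
        rw [Metric.mem_ball]
        calc dist x x₀ ≤ dist x (x + v τ) + dist (x + v τ) x₀ := dist_triangle _ _ _
          _ < ‖v‖ + ρ := by
            have : dist x (x + v τ) = ‖v τ‖ := by simp [dist_eq_norm]
            rw [this]; linarith
          _ = _ := by ring
      rw [this, measure_empty]
  have hmeas : Measurable (fun q : E × F => N.indicator (fun _ => (1 : ℝ≥0∞)) (q.1 + v q.2)) :=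
    (measurable_const.indicator hNm).comp
      (measurable_fst.add (v.continuous.measurable.comp measurable_snd))
  -- Average the translates of `N` by vτ over `T` and apply Tonelli: translation invariance gives
  -- the left side, the slice bound the right side.
  have hkey : ν T * μ N ≤ 2 * μ (Metric.ball x₀ (ρ + ‖v‖)) * ν A := by
    calc ν T * μ N = ∫⁻ τ in T, μ N ∂ν := by simp [mul_comm]
      _ = ∫⁻ τ in T, ∫⁻ x, N.indicator (fun _ => (1 : ℝ≥0∞)) (x + v τ) ∂μ ∂ν := by
          refine lintegral_congr fun τ => ?_
          rw [lintegral_add_right_eq_self (fun x => N.indicator (fun _ => (1 : ℝ≥0∞)) x),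
            lintegral_indicator_const hNm, one_mul]
      _ = ∫⁻ x, ∫⁻ τ in T, N.indicator (fun _ => (1 : ℝ≥0∞)) (x + v τ) ∂ν ∂μ :=
          lintegral_lintegral_swap (f := fun τ x => N.indicator (fun _ => (1 : ℝ≥0∞)) (x + v τ))
            (hmeas.comp measurable_swap).aemeasurable
      _ ≤ ∫⁻ x, (Metric.ball x₀ (ρ + ‖v‖)).indicator (fun _ => 2 * ν A) x ∂μ := by
          refine lintegral_mono fun x => ?_
          refine le_trans (le_of_eq ?_) (hsmall x)
          have hm : MeasurableSet {τ | x + v τ ∈ N} :=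
            (measurable_const.add v.continuous.measurable) hNm
          have : (fun τ => N.indicator (fun _ => (1 : ℝ≥0∞)) (x + v τ)) =
              {τ | x + v τ ∈ N}.indicator (fun _ => 1) := by
            ext τ; simp only [indicator]; rfl
          rw [this, lintegral_indicator_const hm, one_mul, Measure.restrict_apply hm, inter_comm]
      _ = _ := by
          rw [lintegral_indicator_const Metric.isOpen_ball.measurableSet]; ring
  calc μ N = (ν T)⁻¹ * (ν T * μ N) := by
        rw [← mul_assoc, ENNReal.inv_mul_cancel hT0 hTt, one_mul]
    _ ≤ (ν T)⁻¹ * (2 * μ (Metric.ball x₀ (ρ + ‖v‖)) * ν A) := by gcongr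
    _ = _ := by ring

/-- The image of the volume on a compact set under a submersion of class `C¹` has bounded density. -/
theorem exists_map_restrict_le {s : E → F} {C : Set E} (hC : IsCompact C)
    (hs : ∀ x ∈ C, ContDiffAt ℝ 1 s x) (hsurj : ∀ x ∈ C, Function.Surjective (fderiv ℝ s x)) :
    ∃ M : ℝ≥0∞, M ≠ ⊤ ∧ (μ.restrict C).map s ≤ M • ν.restrict (s '' C) := by
  have hcont : ContinuousOn s C := fun x hx => (hs x hx).continuousAt.continuousWithinAt
  have haem : AEMeasurable s (μ.restrict C) := hcont.aemeasurable hC.measurableSet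
  obtain ⟨M, hM, h⟩ : ∃ M : ℝ≥0∞, M ≠ ⊤ ∧
      ∀ A : Set F, MeasurableSet A → μ (C ∩ s ⁻¹' A) ≤ M * ν A := by
    refine hC.induction_on (p := fun C => ∃ M : ℝ≥0∞, M ≠ ⊤ ∧
      ∀ A : Set F, MeasurableSet A → μ (C ∩ s ⁻¹' A) ≤ M * ν A) ⟨0, by simp, by simp⟩ ?_ ?_ ?_
    · rintro s t hst ⟨M, hM, h⟩
      exact ⟨M, hM, fun A hA => (measure_mono (inter_subset_inter_left _ hst)).trans (h A hA)⟩
    · rintro s t ⟨M, hM, h⟩ ⟨M', hM', h'⟩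
      refine ⟨M + M', by simp [hM, hM'], fun A hA => ?_⟩
      rw [union_inter_distrib_right, add_mul]
      exact (measure_union_le _ _).trans (add_le_add (h A hA) (h' A hA))
    · intro x hx
      obtain ⟨U, hU, M, hM, h⟩ := exists_measure_inter_preimage_le μ ν
        ((hs x hx).hasStrictFDerivAt one_ne_zero) (hsurj x hx)
      exact ⟨U, mem_nhdsWithin_of_mem_nhds hU, M, hM, h⟩
  refine ⟨M, hM, Measure.le_iff.2 fun A hA => ?_⟩
  have hsC : MeasurableSet (s '' C) := (hC.image_of_continuousOn hcont).measurableSet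
  rw [Measure.map_apply_of_aemeasurable haem hA, Measure.smul_apply, smul_eq_mul,
    Measure.restrict_apply hA]
  refine le_trans ?_ (h _ (hA.inter hsC))
  rw [Measure.restrict_apply' hC.measurableSet]
  exact measure_mono fun x hx => ⟨hx.2, hx.1, mem_image_of_mem s hx.2⟩

end Pushforward

/-! ### Mollification in L¹ -/

section Mollification

open scoped Convolution
open ContinuousLinearMap (lsmul)

variable {F : Type*} [NormedAddCommGroup F] [NormedSpace ℝ F] [FiniteDimensional ℝ F]
  [MeasurableSpace F] [BorelSpace F] {μ : Measure F} [μ.IsAddHaarMeasure]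

theorem convolutionExists_normed (φ : ContDiffBump (0 : F)) {f : F → ℝ}
    (hf : LocallyIntegrable f μ) : ConvolutionExists (φ.normed μ) f (lsmul ℝ ℝ) μ :=
  φ.hasCompactSupport_normed.convolutionExists_left _ φ.continuous_normed hf

/-- Pointwise |φ ∗ f| ≤ φ ∗ |f|, and the kernel has mass one. -/
theorem integral_norm_convolution_normed_le (φ : ContDiffBump (0 : F)) {f : F → ℝ}
    (hf : Integrable f μ) :
    ∫ x, ‖(φ.normed μ ⋆[lsmul ℝ ℝ, μ] f) x‖ ∂μ ≤ ∫ x, ‖f x‖ ∂μ := by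
  have h1 : ∀ x, ‖(φ.normed μ ⋆[lsmul ℝ ℝ, μ] f) x‖ ≤
      (φ.normed μ ⋆[lsmul ℝ ℝ, μ] fun y => ‖f y‖) x := by
    intro x
    rw [convolution_def, convolution_def]
    refine (norm_integral_le_integral_norm _).trans (le_of_eq ?_)
    refine integral_congr_ae (ae_of_all _ fun t => ?_)
    simp [abs_of_nonneg (φ.nonneg_normed t)]
  have h2 := integral_convolution (μ := μ) (ν := μ) (lsmul ℝ ℝ) φ.integrable_normed hf.norm
  rw [φ.integral_normed] at h2
  refine (integral_mono (φ.integrable_normed.integrable_convolution _ hf).norm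
    (φ.integrable_normed.integrable_convolution _ hf.norm) h1).trans ?_
  rw [h2]; simp

theorem tendsto_integral_norm_convolution_sub_of_continuous {φ : ℕ → ContDiffBump (0 : F)}
    (hφ : Tendsto (fun n => (φ n).rOut) atTop (𝓝 0)) {g : F → ℝ} (hg : Continuous g)
    (hgc : HasCompactSupport g) :
    Tendsto (fun n => ∫ x, ‖((φ n).normed μ ⋆[lsmul ℝ ℝ, μ] g) x - g x‖ ∂μ) atTop (𝓝 0) := by
  obtain ⟨c, hc⟩ := hg.bounded_above_of_compact_support hgc
  set K := Metric.cthickening 1 (tsupport g)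
  have hK : IsCompact K := hgc.isCompact.cthickening
  have : (0 : ℝ) = ∫ x : F, (0 : ℝ) ∂μ := by simp
  rw [this]
  -- Once the bump radius is below 1, the difference lives in the 1-thickening of the support of g
  -- and is at most 2 sup|g|.
  refine tendsto_integral_filter_of_dominated_convergence (K.indicator fun _ => 2 * c) ?_ ?_ ?_ ?_
  · refine Eventually.of_forall fun n => ?_
    exact (((φ n).hasCompactSupport_normed.continuous_convolution_left _
      (φ n).continuous_normed hg.locallyIntegrable).sub hg).norm.aestronglyMeasurable
  · filter_upwards [hφ.eventually (gt_mem_nhds one_pos)] with n hn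
    refine ae_of_all _ fun x => ?_
    by_cases hx : x ∈ K
    · rw [indicator_of_mem hx, norm_norm, ← dist_eq_norm]
      refine ContDiffBump.dist_normed_convolution_le hg.aestronglyMeasurable fun y _ => ?_
      rw [dist_eq_norm]
      linarith [norm_sub_le (g y) (g x), hc x, hc y]
    · have hz : ∀ y ∈ Metric.ball x (φ n).rOut, g y = 0 := by
        intro y hy
        by_contra hne
        refine hx (Metric.mem_cthickening_of_dist_le x y _ _ (subset_tsupport _ hne) ?_)
        rw [dist_comm]; exact ((Metric.mem_ball.1 hy).trans hn).le
      have hx0 := hz x (Metric.mem_ball_self (φ n).rOut_pos)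
      rw [ContDiffBump.normed_convolution_eq_right (fun y hy => by rw [hz y hy, hx0]),
        indicator_of_notMem hx]
      simp
  · exact (integrable_indicator_iff hK.measurableSet).2 (integrableOn_const hK.measure_lt_top.ne)
  · refine ae_of_all _ fun x => ?_
    have := (ContDiffBump.convolution_tendsto_right_of_continuous (μ := μ) hφ hg x).sub_const (g x)
    simpa using this.norm

/-- Mollifications of an integrable function converge to it in `L¹`. -/
theorem tendsto_integral_norm_convolution_sub {φ : ℕ → ContDiffBump (0 : F)}
    (hφ : Tendsto (fun n => (φ n).rOut) atTop (𝓝 0)) {f : F → ℝ} (hf : Integrable f μ) :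
    Tendsto (fun n => ∫ x, ‖((φ n).normed μ ⋆[lsmul ℝ ℝ, μ] f) x - f x‖ ∂μ) atTop (𝓝 0) := by
  rw [Metric.tendsto_nhds]
  intro ε hε
  obtain ⟨g, hgc, hfg, hg, hgi⟩ :=
    hf.exists_hasCompactSupport_integral_sub_le (show 0 < ε / 4 by positivity)
  filter_upwards [(tendsto_integral_norm_convolution_sub_of_continuous (μ := μ) hφ hg
    hgc).eventually (gt_mem_nhds (show 0 < ε / 4 by positivity))] with n hn
  rw [Real.dist_eq, sub_zero, abs_of_nonneg (integral_nonneg fun _ => norm_nonneg _)]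
  -- Three errors of at most ε/4 each: φ∗g − g, φ∗(f − g) and f − g.
  have hdec : ∀ x, ((φ n).normed μ ⋆[lsmul ℝ ℝ, μ] f) x =
      ((φ n).normed μ ⋆[lsmul ℝ ℝ, μ] g) x + ((φ n).normed μ ⋆[lsmul ℝ ℝ, μ] (f - g)) x := by
    intro x
    rw [← (convolutionExists_normed (φ n) hgi.locallyIntegrable x).distrib_add
      (convolutionExists_normed (φ n) (hf.sub hgi).locallyIntegrable x)]
    congr 1; abel
  have hi1 : Integrable (fun x => ‖((φ n).normed μ ⋆[lsmul ℝ ℝ, μ] g) x - g x‖) μ :=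
    (((φ n).integrable_normed.integrable_convolution _ hgi).sub hgi).norm
  have hi2 : Integrable (fun x => ‖((φ n).normed μ ⋆[lsmul ℝ ℝ, μ] (f - g)) x‖) μ :=
    ((φ n).integrable_normed.integrable_convolution _ (hf.sub hgi)).norm
  have hi3 : Integrable (fun x => ‖f x - g x‖) μ := (hf.sub hgi).norm
  have h1 : ∫ x, ‖((φ n).normed μ ⋆[lsmul ℝ ℝ, μ] f) x - f x‖ ∂μ ≤
      ∫ x, (‖((φ n).normed μ ⋆[lsmul ℝ ℝ, μ] g) x - g x‖ +
        ‖((φ n).normed μ ⋆[lsmul ℝ ℝ, μ] (f - g)) x‖ + ‖f x - g x‖) ∂μ := by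
    refine integral_mono (((φ n).integrable_normed.integrable_convolution _ hf).sub hf).norm
      ((hi1.add hi2).add hi3) fun x => ?_
    simp only [hdec x]
    calc _ = ‖(((φ n).normed μ ⋆[lsmul ℝ ℝ, μ] g) x - g x) +
        ((φ n).normed μ ⋆[lsmul ℝ ℝ, μ] (f - g)) x - (f x - g x)‖ := by congr 1; ring
      _ ≤ _ := (norm_sub_le _ _).trans (by gcongr; exact norm_add_le _ _)
  have h4 := integral_add (hi1.add hi2) hi3
  have h5 := integral_add hi1 hi2
  simp only [Pi.add_apply] at h4
  rw [h4, h5] at h1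
  have h2 := integral_norm_convolution_normed_le (φ n) (hf.sub hgi)
  have h3 : ∫ x, ‖(f - g) x‖ ∂μ ≤ ε / 4 := hfg
  linarith

/-- A weakly differentiable function is approximated, together with its partial derivative in any
of finitely many directions, by functions of class `C¹` on compact subsets. -/
theorem exists_contDiff_approx {β : Type*} (e : β → F) {V : Set F} (hV : IsOpen V)
    {h : F → ℝ} {J : F → β → ℝ} (hh : LocallyIntegrableOn h V μ)
    (hJ : ∀ b, LocallyIntegrableOn (fun y => J y b) V μ)
    (hweak : ∀ b, ∀ φ : F → ℝ, ContDiff ℝ ∞ φ → HasCompactSupport φ → tsupport φ ⊆ V →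
      ∫ y, h y * fderiv ℝ φ y (e b) ∂μ = - ∫ y, J y b * φ y ∂μ)
    {L : Set F} (hL : IsCompact L) (hLV : L ⊆ V) :
    ∃ u : ℕ → F → ℝ, (∀ n, ContDiff ℝ 1 (u n)) ∧
      (∀ᵐ y ∂(μ.restrict L), Tendsto (fun n => u n y) atTop (𝓝 (h y))) ∧
      ∀ b, Tendsto (fun n => ∫ y in L, ‖fderiv ℝ (u n) y (e b) - J y b‖ ∂μ) atTop (𝓝 0) := by
  obtain ⟨L', hL', hLL', hL'V⟩ := exists_compact_between hL hV hLV
  set f := L'.indicator h with hf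
  have hfi : Integrable f μ :=
    (integrable_indicator_iff hL'.measurableSet).2 (hh.integrableOn_compact_subset hL'V hL')
  have hJi : ∀ b, Integrable (L'.indicator fun y => J y b) μ := fun b =>
    (integrable_indicator_iff hL'.measurableSet).2 ((hJ b).integrableOn_compact_subset hL'V hL')
  -- The ratio of outer to inner radius stays equal to 2; almost everywhere convergence needs it
  -- bounded.
  let φ : ℕ → ContDiffBump (0 : F) := fun n =>
    ⟨1 / (2 * ((n : ℝ) + 1)), 1 / ((n : ℝ) + 1), by positivity,
      one_div_lt_one_div_of_lt (by positivity) (by linarith [n.cast_nonneg (α := ℝ)])⟩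
  have hφ : Tendsto (fun n => (φ n).rOut) atTop (𝓝 0) := tendsto_one_div_add_atTop_nhds_zero_nat
  have hφK : ∀ᶠ n in atTop, (φ n).rOut ≤ 2 * (φ n).rIn := Eventually.of_forall fun n => by
    change 1 / ((n : ℝ) + 1) ≤ 2 * (1 / (2 * ((n : ℝ) + 1)))
    have : (0 : ℝ) < n + 1 := by positivity
    apply le_of_eq; field_simp
  refine ⟨fun n => (φ n).normed μ ⋆[lsmul ℝ ℝ, μ] f, fun n => ?_, ?_, fun b => ?_⟩
  · exact (φ n).hasCompactSupport_normed.contDiff_convolution_left _ (φ n).contDiff_normed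
      hfi.locallyIntegrable
  · filter_upwards [ae_restrict_of_ae (ContDiffBump.ae_convolution_tendsto_right_of_locallyIntegrable
      hφ hφK hfi.locallyIntegrable), ae_restrict_mem hL.measurableSet] with y hy hyL
    rwa [hf, indicator_of_mem (interior_subset (hLL' hyL))] at hy
  · obtain ⟨δ, hδ, hδL⟩ := hL.exists_cthickening_subset_open isOpen_interior hLL'
    refine squeeze_zero' (Eventually.of_forall fun n => integral_nonneg fun _ => norm_nonneg _) ?_
      (tendsto_integral_norm_convolution_sub (μ := μ) hφ (hJi b))
    filter_upwards [hφ.eventually (gt_mem_nhds hδ)] with n hn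
    have hball : ∀ x ∈ L, Metric.closedBall x (φ n).rOut ⊆ interior L' := fun x hx y hy =>
      hδL (Metric.mem_cthickening_of_dist_le y x _ _ hx ((Metric.mem_closedBall.1 hy).trans hn.le))
    -- For x in `L` and small radius, t ↦ φ(x − t) is a test function supported in `L'`, so the weak
    -- derivative identity applies and the cutoff to `L'` is invisible. The sign from x − t cancels
    -- that of the integration by parts.
    have hderiv : ∀ x ∈ L, fderiv ℝ ((φ n).normed μ ⋆[lsmul ℝ ℝ, μ] f) x (e b) =
        ((φ n).normed μ ⋆[lsmul ℝ ℝ, μ] L'.indicator fun y => J y b) x := by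
      intro x hx
      have hsupp : ∀ t, t ∉ L' → x - t ∉ tsupport ((φ n).normed μ) := by
        intro t ht hmem
        rw [(φ n).tsupport_normed_eq, mem_closedBall_zero_iff] at hmem
        refine ht (interior_subset (hball x hx ?_))
        rwa [Metric.mem_closedBall, dist_comm, dist_eq_norm]
      rw [← convolution_flip, ((φ n).hasCompactSupport_normed.hasFDerivAt_convolution_right _
        hfi.locallyIntegrable (φ n).contDiff_normed x).fderiv,
        convolution_precompR_apply _ hfi.locallyIntegrable
          ((φ n).hasCompactSupport_normed.fderiv ℝ)
          ((φ n).contDiff_normed.continuous_fderiv (n := 1) one_ne_zero), convolution_def,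
        ← convolution_flip, convolution_def]
      have hφd : ∀ t, fderiv ℝ (fun t => (φ n).normed μ (x - t)) t (e b) =
          - fderiv ℝ ((φ n).normed μ) (x - t) (e b) := by
        intro t
        have h1 : HasFDerivAt (fun t => x - t) (-ContinuousLinearMap.id ℝ F) t := by
          simpa using (hasFDerivAt_id t).const_sub x
        have h2 := (((φ n).contDiff_normed (n := 1) (μ := μ)).differentiable one_ne_zero
          (x - t)).hasFDerivAt.comp t h1
        have h3 : fderiv ℝ (fun t => (φ n).normed μ (x - t)) t = _ := h2.fderiv
        rw [h3]; simp
      have hcs : HasCompactSupport (fun t => (φ n).normed μ (x - t)) :=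
        (φ n).hasCompactSupport_normed.comp_homeomorph (Homeomorph.subLeft x)
      have hts : tsupport (fun t => (φ n).normed μ (x - t)) ⊆ V := by
        refine (closure_minimal (fun t ht => ?_) Metric.isClosed_closedBall).trans
          ((hball x hx).trans (interior_subset.trans hL'V))
        have : x - t ∈ Function.support ((φ n).normed μ) := ht
        rw [(φ n).support_normed_eq, mem_ball_zero_iff] at this
        rw [Metric.mem_closedBall, dist_comm, dist_eq_norm]; exact this.le
      have hw := hweak b (fun t => (φ n).normed μ (x - t)) ((φ n).contDiff_normed.comp (contDiff_const.sub contDiff_id)) hcs hts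
      calc _ = - ∫ t, h t * fderiv ℝ (fun t => (φ n).normed μ (x - t)) t (e b) ∂μ := by
            rw [← integral_neg]
            refine integral_congr_ae (ae_of_all _ fun t => ?_)
            simp only [hφd t]
            by_cases ht : t ∈ L'
            · simp [hf, indicator_of_mem ht, mul_comm]
            · have : fderiv ℝ ((φ n).normed μ) (x - t) = 0 :=
                fderiv_of_notMem_tsupport ℝ (hsupp t ht)
              simp [this]
        _ = ∫ t, J t b * (φ n).normed μ (x - t) ∂μ := by rw [hw, neg_neg]
        _ = _ := by
            refine integral_congr_ae (ae_of_all _ fun t => ?_)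
            by_cases ht : t ∈ L'
            · simp [indicator_of_mem ht, mul_comm]
            · have : (φ n).normed μ (x - t) = 0 := image_eq_zero_of_notMem_tsupport (hsupp t ht)
              simp [this]
    have hint : Integrable (fun x => ‖((φ n).normed μ ⋆[lsmul ℝ ℝ, μ] L'.indicator fun y => J y b) x -
        L'.indicator (fun y => J y b) x‖) μ :=
      (((φ n).integrable_normed.integrable_convolution _ (hJi b)).sub (hJi b)).norm
    refine le_trans (le_of_eq ?_) (setIntegral_le_integral (s := L) hint
      (ae_of_all _ fun _ => norm_nonneg _))
    refine setIntegral_congr_fun hL.measurableSet fun x hx => ?_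
    simp only [hderiv x hx, indicator_of_mem (interior_subset (hLL' hx))]

end Mollification

/-! ### Product and chain rule under the integral sign -/

section WeakProduct

/-- Write A_n B_n = A_n B' + A_n(B_n − B'): dominated convergence for the first term, c times the L¹
error for the second. -/
theorem tendsto_integral_mul_of_bounded {α : Type*} [MeasurableSpace α] {μ : Measure α}
    {A : ℕ → α → ℝ} {A' : α → ℝ} {B : ℕ → α → ℝ} {B' : α → ℝ} {c : ℝ}
    (hAm : ∀ n, AEStronglyMeasurable (A n) μ) (hAc : ∀ n, ∀ᵐ x ∂μ, ‖A n x‖ ≤ c)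
    (hA : ∀ᵐ x ∂μ, Tendsto (fun n => A n x) atTop (𝓝 (A' x)))
    (hBi : ∀ n, Integrable (B n) μ) (hB' : Integrable B' μ)
    (hB : Tendsto (fun n => ∫ x, ‖B n x - B' x‖ ∂μ) atTop (𝓝 0)) :
    Tendsto (fun n => ∫ x, A n x * B n x ∂μ) atTop (𝓝 (∫ x, A' x * B' x ∂μ)) := by
  have h1 : Tendsto (fun n => ∫ x, A n x * B' x ∂μ) atTop (𝓝 (∫ x, A' x * B' x ∂μ)) := by
    refine tendsto_integral_of_dominated_convergence (fun x => c * ‖B' x‖)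
      (fun n => (hAm n).mul hB'.aestronglyMeasurable) (hB'.norm.const_mul c) (fun n => ?_) ?_
    · filter_upwards [hAc n] with x hx
      rw [norm_mul]; gcongr
    · filter_upwards [hA] with x hx using hx.mul_const _
  have h2 : Tendsto (fun n => ∫ x, A n x * (B n x - B' x) ∂μ) atTop (𝓝 0) := by
    have h3 := hB.const_mul c
    rw [mul_zero] at h3
    refine squeeze_zero_norm (fun n => ?_) h3
    rw [← integral_const_mul]
    refine (norm_integral_le_integral_norm _).trans (integral_mono_ae
      (((hBi n).sub hB').bdd_mul (hAm n) (hAc n)).norm (((hBi n).sub hB').norm.const_mul c) ?_)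
    filter_upwards [hAc n] with x hx
    simp only [norm_mul]
    gcongr
  have h3 := h1.add h2
  rw [add_zero] at h3
  refine h3.congr fun n => ?_
  refine (integral_add (hB'.bdd_mul (hAm n) (hAc n))
    (((hBi n).sub hB').bdd_mul (hAm n) (hAc n))).symm.trans ?_
  refine integral_congr_ae (ae_of_all _ fun x => ?_)
  simp only [Pi.sub_apply]; ring

variable {E : Type*} [NormedAddCommGroup E] [NormedSpace ℝ E] [FiniteDimensional ℝ E]
  [MeasurableSpace E] [BorelSpace E] (μ : Measure E) [μ.IsAddHaarMeasure]

omit [NormedSpace ℝ E] [FiniteDimensional ℝ E] [BorelSpace E] [μ.IsAddHaarMeasure] in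
theorem integral_eq_setIntegral_tsupport {f : E → ℝ} (ψ : E → ℝ)
    (h : ∀ x, x ∉ tsupport ψ → f x = 0) : ∫ x, f x ∂μ = ∫ x in tsupport ψ, f x ∂μ :=
  (setIntegral_eq_integral_of_forall_compl_eq_zero h).symm

section Comp

variable {F : Type*} [NormedAddCommGroup F] [NormedSpace ℝ F]
  [FiniteDimensional ℝ F] [MeasurableSpace F] [BorelSpace F] (ν : Measure F) [ν.IsAddHaarMeasure]

/-- Composition with a submersion of class `C¹` preserves integrability and null sets on compact
sets, and is bounded for the `L¹` norms. -/
theorem exists_integrable_comp_submersion {s : E → F} {C : Set E} (hC : IsCompact C)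
    (hs : ∀ x ∈ C, ContDiffAt ℝ 1 s x) (hsurj : ∀ x ∈ C, Function.Surjective (fderiv ℝ s x)) :
    (∀ P : F → Prop, (∀ᵐ y ∂(ν.restrict (s '' C)), P y) → ∀ᵐ x ∂(μ.restrict C), P (s x)) ∧
    ∃ M : ℝ, ∀ g : F → ℝ, IntegrableOn g (s '' C) ν →
      IntegrableOn (fun x => g (s x)) C μ ∧
      ∫ x in C, ‖g (s x)‖ ∂μ ≤ M * ∫ y in s '' C, ‖g y‖ ∂ν := by
  obtain ⟨M, hM, hle⟩ := exists_map_restrict_le μ ν hC hs hsurj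
  have haem : AEMeasurable s (μ.restrict C) := ContinuousOn.aemeasurable
    (fun x hx => (hs x hx).continuousAt.continuousWithinAt) hC.measurableSet
  have hac : (μ.restrict C).map s ≪ ν.restrict (s '' C) :=
    (Measure.absolutelyContinuous_of_le hle).trans
      (Measure.smul_absolutelyContinuous)
  refine ⟨fun P hP => ae_of_ae_map haem (hac.ae_le hP), M.toReal, fun g hg => ?_⟩
  have h1 : Integrable g (M • ν.restrict (s '' C)) := hg.smul_measure hM
  have h2 : Integrable g ((μ.restrict C).map s) := h1.mono_measure hle
  refine ⟨h2.comp_aemeasurable haem, ?_⟩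
  rw [← integral_map haem h2.norm.aestronglyMeasurable]
  refine (integral_mono_measure hle (ae_of_all _ fun _ => norm_nonneg _) h1.norm).trans ?_
  rw [integral_smul_measure, smul_eq_mul]

end Comp

variable {κ : Type*} [Fintype κ] [DecidableEq κ] {β : κ → Type*} [∀ k, Fintype (β k)]
  [∀ k, DecidableEq (β k)]

omit [FiniteDimensional ℝ E] [MeasurableSpace E] [BorelSpace E] in
theorem fderiv_prod_comp_apply {s : ∀ k, E → β k → ℝ} {u : ∀ k, (β k → ℝ) → ℝ} {x : E}
    (hs : ∀ k, DifferentiableAt ℝ (s k) x) (hu : ∀ k, DifferentiableAt ℝ (u k) (s k x)) (v : E) :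
    DifferentiableAt ℝ (fun x => ∏ k, u k (s k x)) x ∧
    fderiv ℝ (fun x => ∏ k, u k (s k x)) x v =
      ∑ k, ∑ b, (fderiv ℝ (u k) (s k x) (Pi.single b 1) *
        ∏ l ∈ Finset.univ.erase k, u l (s l x)) * fderiv ℝ (s k) x v b := by
  have h1 : ∀ k, HasFDerivAt (fun x => u k (s k x))
      ((fderiv ℝ (u k) (s k x)).comp (fderiv ℝ (s k) x)) x := fun k =>
    (hu k).hasFDerivAt.comp x (hs k).hasFDerivAt
  have h2 := HasFDerivAt.finsetProd (u := Finset.univ) fun k _ => h1 k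
  refine ⟨h2.differentiableAt, ?_⟩
  rw [h2.fderiv, _root_.sum_apply]
  refine Finset.sum_congr rfl fun k _ => ?_
  have h3 : fderiv ℝ (s k) x v = ∑ b, fderiv ℝ (s k) x v b • (Pi.single b 1 : β k → ℝ) := by
    ext b
    simp [Finset.sum_apply, Pi.single_apply]
  rw [_root_.smul_apply, ContinuousLinearMap.comp_apply]
  conv_lhs => rw [h3, map_sum]
  rw [Finset.smul_sum]
  refine Finset.sum_congr rfl fun b _ => ?_
  rw [map_smul, smul_eq_mul, smul_eq_mul]; ring

variable {s : ∀ k, E → β k → ℝ} {Ω : Set E} {V : ∀ k, Set (β k → ℝ)}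
  {h : ∀ k, (β k → ℝ) → ℝ} {J : ∀ k, (β k → ℝ) → β k → ℝ} {ψ : E → ℝ}

/-- The classical case. The product need only be differentiable on the support of ψ, outside which
every integrand vanishes. -/
theorem integral_prod_comp_mul_fderiv (hs : ∀ k, ∀ x ∈ Ω, ContDiffAt ℝ 1 (s k) x)
    {u : ∀ k, (β k → ℝ) → ℝ} (hu : ∀ k, ContDiff ℝ 1 (u k))
    (hψ : ContDiff ℝ 1 ψ) (hψc : HasCompactSupport ψ) (hψΩ : tsupport ψ ⊆ Ω) (v : E) :
    ∫ x in tsupport ψ, (∏ k, u k (s k x)) * fderiv ℝ ψ x v ∂μ =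
      - ∑ k, ∑ b, ∫ x in tsupport ψ, (fderiv ℝ (u k) (s k x) (Pi.single b 1) *
        ∏ l ∈ Finset.univ.erase k, u l (s l x)) * (fderiv ℝ (s k) x v b * ψ x) ∂μ := by
  have hC : IsCompact (tsupport ψ) := hψc
  have hsd : ∀ k, ∀ x ∈ tsupport ψ, DifferentiableAt ℝ (s k) x := fun k x hx =>
    (hs k x (hψΩ hx)).differentiableAt one_ne_zero
  have hsc : ∀ k, ContinuousOn (s k) (tsupport ψ) := fun k x hx =>
    (hsd k x hx).continuousAt.continuousWithinAt
  have hsc' : ∀ k b, ContinuousOn (fun x => fderiv ℝ (s k) x v b) (tsupport ψ) := fun k b x hx => by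
    have h1 := ((hs k x (hψΩ hx)).fderiv_right (m := 0) (by norm_num)).continuousAt
    exact ((continuous_apply b).continuousAt.comp
      (h1.clm_apply continuousAt_const)).continuousWithinAt
  have hpc : ∀ S : Finset κ, ContinuousOn (fun x => ∏ l ∈ S, u l (s l x)) (tsupport ψ) := fun S =>
    continuousOn_finsetProd _ fun l _ => (hu l).continuous.comp_continuousOn (hsc l)
  have hψ' : Continuous fun x => fderiv ℝ ψ x v :=
    (hψ.continuous_fderiv one_ne_zero).clm_apply continuous_const
  have hfd : ∀ k b, ContinuousOn (fun x => fderiv ℝ (u k) (s k x) (Pi.single b 1)) (tsupport ψ) :=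
    fun k b => (((hu k).continuous_fderiv one_ne_zero).clm_apply
      continuous_const).comp_continuousOn (hsc k)
  have hterm : ∀ k b, IntegrableOn (fun x => (fderiv ℝ (u k) (s k x) (Pi.single b 1) *
        ∏ l ∈ Finset.univ.erase k, u l (s l x)) * (fderiv ℝ (s k) x v b * ψ x)) (tsupport ψ) μ :=
    fun k b => (((hfd k b).mul (hpc _)).mul
      ((hsc' k b).mul hψ.continuous.continuousOn)).integrableOn_compact hC
  have hprod := fun x (hx : x ∈ tsupport ψ) => fderiv_prod_comp_apply (fun k => hsd k x hx)
    (fun k => ((hu k).differentiable one_ne_zero) (s k x)) v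
  have heq : ∀ x ∈ tsupport ψ, fderiv ℝ (fun x => ∏ k, u k (s k x)) x v * ψ x =
      ∑ k, ∑ b, (fderiv ℝ (u k) (s k x) (Pi.single b 1) *
        ∏ l ∈ Finset.univ.erase k, u l (s l x)) * (fderiv ℝ (s k) x v b * ψ x) := by
    intro x hx
    rw [(hprod x hx).2, Finset.sum_mul]
    refine Finset.sum_congr rfl fun k _ => ?_
    rw [Finset.sum_mul]
    exact Finset.sum_congr rfl fun b _ => by ring
  have hψ0 : ∀ x, x ∉ tsupport ψ → ψ x = 0 := fun x hx => image_eq_zero_of_notMem_tsupport hx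
  have hψ0' : ∀ x, x ∉ tsupport ψ → fderiv ℝ ψ x v = 0 := fun x hx => by
    rw [fderiv_of_notMem_tsupport ℝ hx]; rfl
  have hon : ∀ {f : E → ℝ}, (∀ x, x ∉ tsupport ψ → f x = 0) → IntegrableOn f (tsupport ψ) μ →
      Integrable f μ := fun {f} hf hi =>
    (integrableOn_iff_integrable_of_support_subset fun x hx => by
      by_contra hne; exact hx (hf x hne)).1 hi
  have key := integral_mul_fderiv_eq_neg_fderiv_mul_of_integrable (μ := μ)
    (f := fun x => ∏ k, u k (s k x)) (g := ψ) (v := v)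
    (hon (fun x hx => by rw [hψ0 x hx, mul_zero])
      (IntegrableOn.congr_fun (integrable_finsetSum _ fun k _ => integrable_finsetSum _ fun b _ =>
        hterm k b) (fun x hx => (heq x hx).symm) hC.measurableSet))
    (hon (fun x hx => by rw [hψ0' x hx, mul_zero])
      (((hpc Finset.univ).mul hψ'.continuousOn).integrableOn_compact hC))
    (hon (fun x hx => by rw [hψ0 x hx, mul_zero])
      (((hpc Finset.univ).mul hψ.continuous.continuousOn).integrableOn_compact hC))
    (fun x hx => (hprod x hx).1) (fun x _ => hψ.differentiable one_ne_zero x)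
  rw [integral_eq_setIntegral_tsupport μ ψ (fun x hx => by rw [hψ0' x hx, mul_zero]),
    integral_eq_setIntegral_tsupport μ ψ (fun x hx => by rw [hψ0 x hx, mul_zero]),
    setIntegral_congr_fun hC.measurableSet heq, integral_finsetSum _ fun k _ =>
      integrable_finsetSum _ fun b _ => hterm k b] at key
  rw [key]
  congr 1
  exact Finset.sum_congr rfl fun k _ => integral_finsetSum _ fun b _ => hterm k b

end WeakProduct

section WeakProductLimit

variable {E : Type*} [NormedAddCommGroup E] [NormedSpace ℝ E] [FiniteDimensional ℝ E]
  [MeasurableSpace E] [BorelSpace E] (μ : Measure E) [μ.IsAddHaarMeasure]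
  {κ : Type*} [Fintype κ] [DecidableEq κ] {β : κ → Type*} [∀ k, Fintype (β k)]
  [∀ k, DecidableEq (β k)]
  {s : ∀ k, E → β k → ℝ} {Ω : Set E} {V : ∀ k, Set (β k → ℝ)}
  {h : ∀ k, (β k → ℝ) → ℝ} {J : ∀ k, (β k → ℝ) → β k → ℝ} {ψ : E → ℝ}

theorem norm_prod_comp_le {ι α : Type*} (S : Finset ι) {T : ℝ → ℝ} {c : ℝ} (hT : ∀ x, ‖T x‖ ≤ c)
    (w : ι → α → ℝ) (x : α) : ‖∏ l ∈ S, T (w l x)‖ ≤ c ^ S.card := by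
  rw [norm_prod]
  refine (Finset.prod_le_prod (fun _ _ => norm_nonneg _) fun l _ => hT (w l x)).trans ?_
  rw [Finset.prod_const]

/-- Weak product and chain rule for bounded nonlinear functions of weakly differentiable functions
composed with submersions. -/
theorem integral_prod_bounded_comp_mul_fderiv
    (hs : ∀ k, ∀ x ∈ Ω, ContDiffAt ℝ 1 (s k) x)
    (hsurj : ∀ k, ∀ x ∈ Ω, Function.Surjective (fderiv ℝ (s k) x))
    (hV : ∀ k, IsOpen (V k)) (hsV : ∀ k, ∀ x ∈ Ω, s k x ∈ V k)
    (hh : ∀ k, LocallyIntegrableOn (h k) (V k))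
    (hJ : ∀ k b, LocallyIntegrableOn (fun y => J k y b) (V k))
    (hweak : ∀ k b, ∀ φ : (β k → ℝ) → ℝ, ContDiff ℝ ∞ φ → HasCompactSupport φ →
      tsupport φ ⊆ V k →
      ∫ y, h k y * fderiv ℝ φ y (Pi.single b 1) = - ∫ y, J k y b * φ y)
    {T : ℝ → ℝ} (hT : ContDiff ℝ 1 T) {c : ℝ} (hTc : ∀ x, ‖T x‖ ≤ c) (hTc' : ∀ x, ‖deriv T x‖ ≤ c)
    (hψ : ContDiff ℝ 1 ψ) (hψc : HasCompactSupport ψ) (hψΩ : tsupport ψ ⊆ Ω) (v : E) :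
    ∫ x in tsupport ψ, (∏ k, T (h k (s k x))) * fderiv ℝ ψ x v ∂μ =
      - ∑ k, ∑ b, ∫ x in tsupport ψ, (deriv T (h k (s k x)) * J k (s k x) b *
        ∏ l ∈ Finset.univ.erase k, T (h l (s l x))) * (fderiv ℝ (s k) x v b * ψ x) ∂μ := by
  have hc : 0 ≤ c := (norm_nonneg _).trans (hTc 0)
  have hC : IsCompact (tsupport ψ) := hψc
  have hsC : ∀ k, ∀ x ∈ tsupport ψ, ContDiffAt ℝ 1 (s k) x := fun k x hx => hs k x (hψΩ hx)
  have hsc : ∀ k, ContinuousOn (s k) (tsupport ψ) := fun k x hx =>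
    (hsC k x hx).continuousAt.continuousWithinAt
  have hsc' : ∀ k b, ContinuousOn (fun x => fderiv ℝ (s k) x v b * ψ x) (tsupport ψ) :=
    fun k b x hx => by
      have h1 := ((hsC k x hx).fderiv_right (m := 0) (by norm_num)).continuousAt
      exact (((continuous_apply b).continuousAt.comp
        (h1.clm_apply continuousAt_const)).mul hψ.continuous.continuousAt).continuousWithinAt
  have hLc : ∀ k, IsCompact (s k '' tsupport ψ) := fun k => hC.image_of_continuousOn (hsc k)
  have hLV : ∀ k, s k '' tsupport ψ ⊆ V k := by
    rintro k _ ⟨x, hx, rfl⟩; exact hsV k x (hψΩ hx)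
  -- C¹ approximations of each `h k` on the compact image of the support of ψ, converging almost
  -- everywhere with partial derivatives converging in L¹.
  choose u huC huT huJ using fun k => exists_contDiff_approx (μ := volume)
    (fun b : β k => (Pi.single b 1 : β k → ℝ)) (hV k) (hh k) (hJ k) (hweak k) (hLc k) (hLV k)
  have hcomp := fun k => exists_integrable_comp_submersion μ (volume : Measure (β k → ℝ)) hC
    (hsC k) fun x hx => hsurj k x (hψΩ hx)
  have hae : ∀ k, ∀ᵐ x ∂(μ.restrict (tsupport ψ)),
      Tendsto (fun n => u k n (s k x)) atTop (𝓝 (h k (s k x))) := fun k => (hcomp k).1 _ (huT k)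
  have hae' := eventually_all.2 hae
  have hfd : ∀ k n b, ContinuousOn (fun x => fderiv ℝ (u k n) (s k x) (Pi.single b 1))
      (tsupport ψ) := fun k n b => (((huC k n).continuous_fderiv one_ne_zero).clm_apply
        continuous_const).comp_continuousOn (hsc k)
  have hJi : ∀ k b, IntegrableOn (fun y => J k y b) (s k '' tsupport ψ) := fun k b =>
    (hJ k b).integrableOn_compact_subset (hLV k) (hLc k)
  have hJL : ∀ k b, Tendsto (fun n => ∫ x in tsupport ψ,
      ‖fderiv ℝ (u k n) (s k x) (Pi.single b 1) - J k (s k x) b‖ ∂μ) atTop (𝓝 0) := by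
    intro k b
    obtain ⟨M, hM⟩ := (hcomp k).2
    have h1 := (huJ k b).const_mul M
    rw [mul_zero] at h1
    refine squeeze_zero (fun n => integral_nonneg fun _ => norm_nonneg _) (fun n => ?_) h1
    refine (hM (fun y => fderiv ℝ (u k n) y (Pi.single b 1) - J k y b) ?_).2
    exact ((((huC k n).continuous_fderiv one_ne_zero).clm_apply
      continuous_const).continuousOn.integrableOn_compact (hLc k)).sub (hJi k b)
  have hTu : ∀ k n, ContDiff ℝ 1 fun y => T (u k n y) := fun k n => hT.comp (huC k n)
  have hpc : ∀ (S : Finset κ) n, ContinuousOn (fun x => ∏ l ∈ S, T (u l n (s l x))) (tsupport ψ) :=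
    fun S n => continuousOn_finsetProd _ fun l _ => (hTu l n).continuous.comp_continuousOn (hsc l)
  have hψ' : Continuous fun x => fderiv ℝ ψ x v :=
    (hψ.continuous_fderiv one_ne_zero).clm_apply continuous_const
  obtain ⟨c₁, hc₁⟩ := hC.exists_bound_of_continuousOn hψ'.continuousOn
  choose c₂ hc₂ using fun k b => hC.exists_bound_of_continuousOn (hsc' k b)
  have hlimP : ∀ S : Finset κ, ∀ᵐ x ∂(μ.restrict (tsupport ψ)),
      Tendsto (fun n => ∏ l ∈ S, T (u l n (s l x))) atTop (𝓝 (∏ l ∈ S, T (h l (s l x)))) := by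
    intro S
    filter_upwards [hae'] with x hx
    exact tendsto_finsetProd _ fun l _ => (hT.continuous.tendsto _).comp (hx l)
  have hlimL : Tendsto (fun n => ∫ x in tsupport ψ, (∏ k, T (u k n (s k x))) * fderiv ℝ ψ x v ∂μ)
      atTop (𝓝 (∫ x in tsupport ψ, (∏ k, T (h k (s k x))) * fderiv ℝ ψ x v ∂μ)) := by
    refine tendsto_integral_of_dominated_convergence
      (fun _ => c ^ (Finset.univ : Finset κ).card * c₁)
      (fun n => ((hpc _ n).mul hψ'.continuousOn).aestronglyMeasurable hC.measurableSet)
      (integrableOn_const hC.measure_lt_top.ne) (fun n => ?_) ?_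
    · filter_upwards [ae_restrict_mem hC.measurableSet] with x hx
      rw [norm_mul]
      gcongr
      · exact norm_prod_comp_le Finset.univ hTc (fun l x => u l n (s l x)) x
      · exact hc₁ x hx
    · filter_upwards [hlimP Finset.univ] with x hx using hx.mul_const _
  have hlimR : ∀ k b, Tendsto (fun n => ∫ x in tsupport ψ,
      (fderiv ℝ (fun y => T (u k n y)) (s k x) (Pi.single b 1) *
        ∏ l ∈ Finset.univ.erase k, T (u l n (s l x))) * (fderiv ℝ (s k) x v b * ψ x) ∂μ) atTop
      (𝓝 (∫ x in tsupport ψ, (deriv T (h k (s k x)) * J k (s k x) b *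
        ∏ l ∈ Finset.univ.erase k, T (h l (s l x))) * (fderiv ℝ (s k) x v b * ψ x) ∂μ)) := by
    intro k b
    -- Only the derivative of the k-th factor is unbounded, and it converges in L¹; everything else
    -- is bounded because T and T' are, and converges almost everywhere.
    have h1 := tendsto_integral_mul_of_bounded (μ := μ.restrict (tsupport ψ))
      (A := fun n x => deriv T (u k n (s k x)) * (∏ l ∈ Finset.univ.erase k, T (u l n (s l x))) *
        (fderiv ℝ (s k) x v b * ψ x))
      (A' := fun x => deriv T (h k (s k x)) * (∏ l ∈ Finset.univ.erase k, T (h l (s l x))) *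
        (fderiv ℝ (s k) x v b * ψ x))
      (B := fun n x => fderiv ℝ (u k n) (s k x) (Pi.single b 1)) (B' := fun x => J k (s k x) b)
      (c := c * c ^ (Finset.univ.erase k).card * c₂ k b) (fun n => ?_) (fun n => ?_) ?_
      (fun n => (hfd k n b).integrableOn_compact hC) ?_ (hJL k b)
    · have h5 : ∀ x, deriv T (h k (s k x)) * (∏ l ∈ Finset.univ.erase k, T (h l (s l x))) *
          (fderiv ℝ (s k) x v b * ψ x) * J k (s k x) b = (deriv T (h k (s k x)) * J k (s k x) b *
          ∏ l ∈ Finset.univ.erase k, T (h l (s l x))) * (fderiv ℝ (s k) x v b * ψ x) :=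
        fun x => by ring
      simp only [h5] at h1
      refine h1.congr fun n => integral_congr_ae (ae_of_all _ fun x => ?_)
      have h2 := ((hT.differentiable one_ne_zero _).hasDerivAt.comp_hasFDerivAt (s k x)
        ((huC k n).differentiable one_ne_zero (s k x)).hasFDerivAt).fderiv
      have h3 : fderiv ℝ (fun y => T (u k n y)) (s k x) = _ := h2
      simp only [h3, _root_.smul_apply, smul_eq_mul]
      ring
    · exact ((((hT.continuous_deriv le_rfl).comp (huC k n).continuous).comp_continuousOn
        (hsc k)).mul (hpc _ n)).mul (hsc' k b) |>.aestronglyMeasurable hC.measurableSet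
    · filter_upwards [ae_restrict_mem hC.measurableSet] with x hx
      rw [norm_mul, norm_mul]
      gcongr
      · exact hTc' _
      · exact norm_prod_comp_le _ hTc (fun l x => u l n (s l x)) x
      · exact hc₂ k b x hx
    · filter_upwards [hlimP (Finset.univ.erase k), hae k] with x hx hx'
      exact ((((hT.continuous_deriv le_rfl).tendsto _).comp hx').mul hx).mul_const _
    · obtain ⟨M, hM⟩ := (hcomp k).2
      exact (hM _ (hJi k b)).1
  refine tendsto_nhds_unique hlimL ?_
  have hlim := (tendsto_finsetSum Finset.univ fun k _ =>
    tendsto_finsetSum Finset.univ fun b _ => hlimR k b).neg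
  refine hlim.congr fun n => ?_
  exact (integral_prod_comp_mul_fderiv μ hs (fun k => hTu k n) hψ hψc hψΩ v).symm

end WeakProductLimit

/-! ### Bounded truncations of the identity -/

section Truncation

/-- A smooth bounded approximation of the identity of `ℝ`. -/
def softTrunc (ε x : ℝ) : ℝ := x / (1 + ε * x ^ 2)

variable {ε : ℝ}

theorem softTrunc_den_pos (hε : 0 < ε) (x : ℝ) : 0 < 1 + ε * x ^ 2 := by positivity

theorem contDiff_softTrunc (hε : 0 < ε) : ContDiff ℝ 1 (softTrunc ε) := by
  unfold softTrunc
  exact contDiff_id.div (by fun_prop) fun x => (softTrunc_den_pos hε x).ne'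

theorem norm_softTrunc_le_norm (hε : 0 < ε) (x : ℝ) : ‖softTrunc ε x‖ ≤ ‖x‖ := by
  rw [softTrunc, norm_div, Real.norm_of_nonneg (softTrunc_den_pos hε x).le]
  exact div_le_self (norm_nonneg _) (by nlinarith [sq_nonneg x])

theorem norm_softTrunc_le (hε : 0 < ε) (x : ℝ) : ‖softTrunc ε x‖ ≤ 1 / ε + 1 := by
  rw [softTrunc, norm_div, Real.norm_of_nonneg (softTrunc_den_pos hε x).le,
    div_le_iff₀ (softTrunc_den_pos hε x), Real.norm_eq_abs]
  -- The expanded product contains 1 + x², which already dominates |x|; the bound is deliberately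
  -- crude.
  have h1 : (1 / ε + 1) * (1 + ε * x ^ 2) = 1 / ε + 1 + x ^ 2 + ε * x ^ 2 := by field_simp; ring
  have h2 : 0 < 1 / ε := by positivity
  have h3 : 0 ≤ ε * x ^ 2 := by positivity
  rw [h1]
  nlinarith [sq_abs x, sq_nonneg (|x| - 1)]

theorem deriv_softTrunc (hε : 0 < ε) (x : ℝ) :
    deriv (softTrunc ε) x = (1 - ε * x ^ 2) / (1 + ε * x ^ 2) ^ 2 := by
  have h1 : HasDerivAt (fun x : ℝ => 1 + ε * x ^ 2) (ε * (2 * x)) x := by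
    simpa using ((hasDerivAt_pow 2 x).const_mul ε).const_add 1
  have h2 := (hasDerivAt_id x).div h1 (softTrunc_den_pos hε x).ne'
  have h3 : deriv (softTrunc ε) x = _ := h2.deriv
  rw [h3]
  congr 1
  simp only [id]; ring

theorem norm_deriv_softTrunc_le (hε : 0 < ε) (x : ℝ) : ‖deriv (softTrunc ε) x‖ ≤ 1 := by
  have h := softTrunc_den_pos hε x
  have h3 : 0 ≤ ε * x ^ 2 := by positivity
  rw [deriv_softTrunc hε, norm_div, norm_pow, Real.norm_of_nonneg h.le, div_le_one (by positivity),
    Real.norm_eq_abs, abs_le]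
  constructor <;> nlinarith

theorem tendsto_softTrunc (x : ℝ) :
    Tendsto (fun n : ℕ => softTrunc (1 / ((n : ℝ) + 1)) x) atTop (𝓝 x) := by
  have h1 : Tendsto (fun n : ℕ => 1 + 1 / ((n : ℝ) + 1) * x ^ 2) atTop (𝓝 (1 + 0 * x ^ 2)) :=
    (tendsto_one_div_add_atTop_nhds_zero_nat.mul_const _).const_add _
  have h2 := (tendsto_const_nhds (x := x)).div h1 (by simp)
  simpa [softTrunc, Pi.div_def] using h2

theorem tendsto_deriv_softTrunc (x : ℝ) :
    Tendsto (fun n : ℕ => deriv (softTrunc (1 / ((n : ℝ) + 1))) x) atTop (𝓝 1) := by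
  have h0 : Tendsto (fun n : ℕ => 1 / ((n : ℝ) + 1) * x ^ 2) atTop (𝓝 (0 * x ^ 2)) :=
    tendsto_one_div_add_atTop_nhds_zero_nat.mul_const _
  have h2 := (h0.const_sub 1).div ((h0.const_add 1).pow 2) (by simp)
  have h3 : ∀ n : ℕ, deriv (softTrunc (1 / ((n : ℝ) + 1))) x = _ := fun n =>
    deriv_softTrunc (by positivity) x
  simp only [h3]
  simpa [Pi.div_def] using h2

end Truncation

/-! ### Removing the truncation -/

section WeakProductFinal

variable {E : Type*} [NormedAddCommGroup E] [NormedSpace ℝ E] [FiniteDimensional ℝ E]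
  [MeasurableSpace E] [BorelSpace E] (μ : Measure E) [μ.IsAddHaarMeasure]
  {κ : Type*} [Fintype κ] [DecidableEq κ] {β : κ → Type*} [∀ k, Fintype (β k)]
  [∀ k, DecidableEq (β k)]
  {s : ∀ k, E → β k → ℝ} {Ω : Set E} {V : ∀ k, Set (β k → ℝ)}
  {h : ∀ k, (β k → ℝ) → ℝ} {J : ∀ k, (β k → ℝ) → β k → ℝ} {ψ : E → ℝ}

/-- Weak product and chain rule for products of weakly differentiable functions composed with
submersions of class `C¹`. -/
theorem integral_weak_prod_comp_mul_fderiv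
    (hs : ∀ k, ∀ x ∈ Ω, ContDiffAt ℝ 1 (s k) x)
    (hsurj : ∀ k, ∀ x ∈ Ω, Function.Surjective (fderiv ℝ (s k) x))
    (hV : ∀ k, IsOpen (V k)) (hsV : ∀ k, ∀ x ∈ Ω, s k x ∈ V k)
    (hh : ∀ k, LocallyIntegrableOn (h k) (V k))
    (hJ : ∀ k b, LocallyIntegrableOn (fun y => J k y b) (V k))
    (hweak : ∀ k b, ∀ φ : (β k → ℝ) → ℝ, ContDiff ℝ ∞ φ → HasCompactSupport φ →
      tsupport φ ⊆ V k →
      ∫ y, h k y * fderiv ℝ φ y (Pi.single b 1) = - ∫ y, J k y b * φ y)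
    (hint : LocallyIntegrableOn (fun x => ∏ k, h k (s k x)) Ω μ)
    (hint' : ∀ k b, LocallyIntegrableOn (fun x => J k (s k x) b *
      ∏ l ∈ Finset.univ.erase k, h l (s l x)) Ω μ)
    (hψ : ContDiff ℝ 1 ψ) (hψc : HasCompactSupport ψ) (hψΩ : tsupport ψ ⊆ Ω) (v : E) :
    ∫ x, (∏ k, h k (s k x)) * fderiv ℝ ψ x v ∂μ =
      - ∑ k, ∑ b, ∫ x, (J k (s k x) b *
        ∏ l ∈ Finset.univ.erase k, h l (s l x)) * (fderiv ℝ (s k) x v b * ψ x) ∂μ := by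
  have hψ0 : ∀ x, x ∉ tsupport ψ → ψ x = 0 := fun x hx => image_eq_zero_of_notMem_tsupport hx
  have hψ0' : ∀ x, x ∉ tsupport ψ → fderiv ℝ ψ x v = 0 := fun x hx => by
    rw [fderiv_of_notMem_tsupport ℝ hx]; rfl
  have hC : IsCompact (tsupport ψ) := hψc
  have hsC : ∀ k, ∀ x ∈ tsupport ψ, ContDiffAt ℝ 1 (s k) x := fun k x hx => hs k x (hψΩ hx)
  have hsc : ∀ k, ContinuousOn (s k) (tsupport ψ) := fun k x hx =>
    (hsC k x hx).continuousAt.continuousWithinAt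
  have hsc' : ∀ k b, ContinuousOn (fun x => fderiv ℝ (s k) x v b * ψ x) (tsupport ψ) :=
    fun k b x hx => by
      have h1 := ((hsC k x hx).fderiv_right (m := 0) (by norm_num)).continuousAt
      exact (((continuous_apply b).continuousAt.comp
        (h1.clm_apply continuousAt_const)).mul hψ.continuous.continuousAt).continuousWithinAt
  have hLV : ∀ k, s k '' tsupport ψ ⊆ V k := by
    rintro k _ ⟨x, hx, rfl⟩; exact hsV k x (hψΩ hx)
  have hLc : ∀ k, IsCompact (s k '' tsupport ψ) := fun k => hC.image_of_continuousOn (hsc k)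
  have hcomp := fun k => exists_integrable_comp_submersion μ (volume : Measure (β k → ℝ)) hC
    (hsC k) fun x hx => hsurj k x (hψΩ hx)
  have hhm : ∀ k, AEStronglyMeasurable (fun x => h k (s k x)) (μ.restrict (tsupport ψ)) := fun k => by
    obtain ⟨M, hM⟩ := (hcomp k).2
    exact (hM _ ((hh k).integrableOn_compact_subset (hLV k) (hLc k))).1.aestronglyMeasurable
  have hJm : ∀ k b, AEStronglyMeasurable (fun x => J k (s k x) b) (μ.restrict (tsupport ψ)) :=
    fun k b => by
      obtain ⟨M, hM⟩ := (hcomp k).2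
      exact (hM _ ((hJ k b).integrableOn_compact_subset (hLV k) (hLc k))).1.aestronglyMeasurable
  have hψ' : Continuous fun x => fderiv ℝ ψ x v :=
    (hψ.continuous_fderiv one_ne_zero).clm_apply continuous_const
  let T : ℕ → ℝ → ℝ := fun n => softTrunc (1 / ((n : ℝ) + 1))
  have hε : ∀ n : ℕ, 0 < 1 / ((n : ℝ) + 1) := fun n => by positivity
  have hTc : ∀ n, ContDiff ℝ 1 (T n) := fun n => contDiff_softTrunc (hε n)
  have hTb : ∀ n x, ‖T n x‖ ≤ ‖x‖ := fun n x => norm_softTrunc_le_norm (hε n) x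
  have hprod : ∀ (S : Finset κ) n x, ‖∏ l ∈ S, T n (h l (s l x))‖ ≤ ‖∏ l ∈ S, h l (s l x)‖ := by
    intro S n x
    rw [norm_prod, norm_prod]
    exact Finset.prod_le_prod (fun _ _ => norm_nonneg _) fun l _ => hTb n _
  have hprodm : ∀ (S : Finset κ) n, AEStronglyMeasurable (fun x => ∏ l ∈ S, T n (h l (s l x)))
      (μ.restrict (tsupport ψ)) := fun S n =>
    Finset.aestronglyMeasurable_fun_prod _ fun l _ =>
      (hTc n).continuous.comp_aestronglyMeasurable (hhm l)
  rw [integral_eq_setIntegral_tsupport μ ψ (fun x hx => by rw [hψ0' x hx, mul_zero])]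
  have hR : ∀ k b, ∫ x, (J k (s k x) b * ∏ l ∈ Finset.univ.erase k, h l (s l x)) *
        (fderiv ℝ (s k) x v b * ψ x) ∂μ =
      ∫ x in tsupport ψ, (J k (s k x) b * ∏ l ∈ Finset.univ.erase k, h l (s l x)) *
        (fderiv ℝ (s k) x v b * ψ x) ∂μ := fun k b =>
    integral_eq_setIntegral_tsupport μ ψ (fun x hx => by rw [hψ0 x hx, mul_zero, mul_zero])
  simp only [hR]
  have hlimL : Tendsto (fun n => ∫ x in tsupport ψ, (∏ k, T n (h k (s k x))) * fderiv ℝ ψ x v ∂μ)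
      atTop (𝓝 (∫ x in tsupport ψ, (∏ k, h k (s k x)) * fderiv ℝ ψ x v ∂μ)) := by
    -- Since |T(x)| ≤ |x|, the untruncated integrand dominates; `hint` makes it integrable. The
    -- terms with a derivative use |T'| ≤ 1 and `hint'` in the same way.
    refine tendsto_integral_of_dominated_convergence
      (fun x => ‖(∏ k, h k (s k x)) * fderiv ℝ ψ x v‖)
      (fun n => (hprodm _ n).mul (hψ'.continuousOn.aestronglyMeasurable hC.measurableSet))
      ((hint.integrableOn_compact_subset hψΩ hC).mul_continuousOn hψ'.continuousOn hC).norm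
      (fun n => ae_of_all _ fun x => ?_) (ae_of_all _ fun x => ?_)
    · rw [norm_mul, norm_mul]
      gcongr
      exact hprod _ n x
    · exact (tendsto_finsetProd _ fun l _ => tendsto_softTrunc _).mul_const _
  have hlimR : ∀ k b, Tendsto (fun n => ∫ x in tsupport ψ, (deriv (T n) (h k (s k x)) *
      J k (s k x) b * ∏ l ∈ Finset.univ.erase k, T n (h l (s l x))) *
        (fderiv ℝ (s k) x v b * ψ x) ∂μ) atTop
      (𝓝 (∫ x in tsupport ψ, (J k (s k x) b * ∏ l ∈ Finset.univ.erase k, h l (s l x)) *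
        (fderiv ℝ (s k) x v b * ψ x) ∂μ)) := by
    intro k b
    refine tendsto_integral_of_dominated_convergence
      (fun x => ‖(J k (s k x) b * ∏ l ∈ Finset.univ.erase k, h l (s l x)) *
        (fderiv ℝ (s k) x v b * ψ x)‖)
      (fun n => (((((hTc n).continuous_deriv le_rfl).comp_aestronglyMeasurable (hhm k)).mul
        (hJm k b)).mul (hprodm _ n)).mul ((hsc' k b).aestronglyMeasurable hC.measurableSet))
      (((hint' k b).integrableOn_compact_subset hψΩ hC).mul_continuousOn (hsc' k b) hC).norm
      (fun n => ae_of_all _ fun x => ?_) (ae_of_all _ fun x => ?_)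
    · rw [norm_mul, norm_mul (_ * _), norm_mul (_ * _), norm_mul (deriv _ _), norm_mul (J k _ b)]
      have h1 := norm_deriv_softTrunc_le (hε n) (h k (s k x))
      have h2 := hprod (Finset.univ.erase k) n x
      calc _ ≤ 1 * ‖J k (s k x) b‖ * ‖∏ l ∈ Finset.univ.erase k, h l (s l x)‖ *
            ‖fderiv ℝ (s k) x v b * ψ x‖ := by gcongr
        _ = _ := by rw [one_mul]
    · have h1 := ((((tendsto_deriv_softTrunc (h k (s k x))).mul_const (J k (s k x) b)).mul
        (tendsto_finsetProd (Finset.univ.erase k) fun l _ =>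
          tendsto_softTrunc (h l (s l x))))).mul_const (fderiv ℝ (s k) x v b * ψ x)
      rwa [one_mul] at h1
  refine tendsto_nhds_unique hlimL ?_
  have hlim := (tendsto_finsetSum Finset.univ fun k _ =>
    tendsto_finsetSum Finset.univ fun b _ => hlimR k b).neg
  refine hlim.congr fun n => ?_
  refine (integral_prod_bounded_comp_mul_fderiv μ hs hsurj hV hsV hh hJ hweak (hTc n)
    -- One constant must bound both T and T'; being at least 1, this one does.
    (c := 1 / (1 / ((n : ℝ) + 1)) + 1) (norm_softTrunc_le (hε n)) (fun x =>
      (norm_deriv_softTrunc_le (hε n) x).trans ?_) hψ hψc hψΩ v).symm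
  have := hε n
  have : 0 < 1 / (1 / ((n : ℝ) + 1)) := by positivity
  linarith

end WeakProductFinal

/-! ### Regularity of simple ordered eigenvalues -/

section Eigenvalues

/-- The choice of indices is a strictly increasing self-map of `Fin n`, hence the identity. This
matches locally constructed root branches with the ordered eigenvalues without assuming the latter
continuous. -/
theorem strictAnti_eq_of_forall_exists {n : ℕ} {u l : Fin n → ℝ} (hu : StrictAnti u)
    (hl : Antitone l) (h : ∀ a, ∃ b, u a = l b) : u = l := by
  choose π hπ using h
  have hmono : StrictMono π := by
    intro a b hab
    by_contra hle
    have h1 := hl (not_lt.1 hle)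
    rw [← hπ, ← hπ] at h1
    exact absurd (hu hab) (not_lt.2 h1)
  have hid : π = id := (hmono.range_inj strictMono_id).1 (by
    rw [(Finite.injective_iff_surjective.1 hmono.injective).range_eq, range_id])
  funext a
  rw [hπ a, hid, id]

variable {E : Type*} [NormedAddCommGroup E] [NormedSpace ℝ E]

theorem contDiffAt_det {ι : Type*} [Fintype ι] [DecidableEq ι] {A : E → Matrix ι ι ℝ} {x : E}
    (hA : ∀ i j, ContDiffAt ℝ 1 (fun y => A y i j) x) :
    ContDiffAt ℝ 1 (fun y => (A y).det) x := by
  simp only [Matrix.det_apply']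
  exact ContDiffAt.sum fun σ _ => contDiffAt_const.mul (contDiffAt_prod fun i _ => hA _ _)

theorem contDiffAt_adjugate {ι : Type*} [Fintype ι] [DecidableEq ι] {A : E → Matrix ι ι ℝ} {x : E}
    (hA : ∀ i j, ContDiffAt ℝ 1 (fun y => A y i j) x) (i j : ι) :
    ContDiffAt ℝ 1 (fun y => (A y).adjugate i j) x := by
  simp only [Matrix.adjugate_apply]
  refine contDiffAt_det fun a b => ?_
  simp only [Matrix.updateRow_apply]
  split_ifs
  · exact contDiffAt_const
  · exact hA _ _

variable [CompleteSpace E]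

/-- Ordered roots of a family of characteristic polynomials depend on the parameter in a `C¹` way
where they are simple. -/
theorem contDiffAt_ordered_eigenvalues {n : ℕ} {M : E → Matrix (Fin n) (Fin n) ℝ}
    {l : E → Fin n → ℝ} {x₀ : E} (hM : ∀ i j, ContDiff ℝ 1 (fun x => M x i j))
    (hl : ∀ x, Antitone (l x))
    (hdet : ∀ x t, (Matrix.diagonal (fun _ => t) - M x).det = ∏ a, (t - l x a))
    (hinj : Function.Injective (l x₀)) (a : Fin n) :
    ContDiffAt ℝ 1 (fun x => l x a) x₀ := by
  let f : E × ℝ → ℝ := fun q => (Matrix.diagonal (fun _ => q.2) - M q.1).det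
  have hf : ContDiff ℝ 1 f := by
    refine contDiff_iff_contDiffAt.2 fun q => contDiffAt_det fun i j => ?_
    simp only [Matrix.sub_apply, Matrix.diagonal_apply]
    refine ContDiffAt.sub ?_ ((hM i j).comp contDiff_fst).contDiffAt
    split_ifs
    · exact contDiff_snd.contDiffAt
    · exact contDiffAt_const
  -- The t-derivative of ∏(t − l_c) at the root l_b is ∏_{c≠b}(l_b − l_c), nonzero because the roots
  -- are simple.
  have hinv : ∀ b, (fderiv ℝ f (x₀, l x₀ b) ∘L .inr ℝ E ℝ).IsInvertible := by
    intro b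
    have hc : ∏ c ∈ Finset.univ.erase b, (l x₀ b - l x₀ c) ≠ 0 :=
      Finset.prod_ne_zero_iff.2 fun c hc =>
        sub_ne_zero.2 fun h => (Finset.mem_erase.1 hc).1 (hinj h).symm
    refine ⟨ContinuousLinearEquiv.unitsEquivAut ℝ (Units.mk0 _ hc), ?_⟩
    have h1 : HasFDerivAt (fun t => f (x₀, t)) (fderiv ℝ f (x₀, l x₀ b) ∘L .inr ℝ E ℝ) (l x₀ b) :=
      (hf.differentiable one_ne_zero (x₀, l x₀ b)).hasFDerivAt.comp (l x₀ b)
        (hasFDerivAt_prodMk_right x₀ (l x₀ b))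
    have h2 : HasDerivAt (fun t => f (x₀, t))
        (∏ c ∈ Finset.univ.erase b, (l x₀ b - l x₀ c)) (l x₀ b) := by
      have h3 := HasDerivAt.fun_finsetProd (u := Finset.univ)
        fun c (_ : c ∈ Finset.univ) => (hasDerivAt_id (l x₀ b)).sub_const (l x₀ c)
      simp only [id] at h3
      refine (h3.congr_deriv ?_).congr_of_eventuallyEq (Eventually.of_forall fun t => hdet x₀ t)
      rw [Finset.sum_eq_single b]
      · simp
      · intro c _ hcb
        rw [Finset.prod_eq_zero (Finset.mem_erase.2 ⟨Ne.symm hcb, Finset.mem_univ b⟩) (sub_self _),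
          zero_smul]
      · simp
    have h4 := h1.unique h2.hasFDerivAt
    rw [h4]
    ext; simp
  let ψ : Fin n → E → ℝ := fun b =>
    (hf.contDiffAt (x := (x₀, l x₀ b))).implicitFunction one_ne_zero (hinv b)
  have hψ : ∀ b, ContDiffAt ℝ 1 (ψ b) x₀ := fun b =>
    ContDiffAt.contDiffAt_implicitFunction (hf.contDiffAt (x := (x₀, l x₀ b))) one_ne_zero (hinv b)
  have hψ0 : ∀ b, ψ b x₀ = l x₀ b := fun b =>
    ContDiffAt.implicitFunction_apply_self (hf.contDiffAt (x := (x₀, l x₀ b))) one_ne_zero (hinv b)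
  have hroot : ∀ b, ∀ᶠ x in 𝓝 x₀, ∃ c, ψ b x = l x c := fun b => by
    filter_upwards [ContDiffAt.eventually_apply_implicitFunction
      (hf.contDiffAt (x := (x₀, l x₀ b))) one_ne_zero (hinv b)] with x hx
    have h1 : f (x₀, l x₀ b) = 0 := by
      rw [show f (x₀, l x₀ b) = _ from hdet x₀ (l x₀ b)]
      exact Finset.prod_eq_zero (Finset.mem_univ b) (sub_self _)
    rw [h1, show f (x, _) = _ from hdet x _, Finset.prod_eq_zero_iff] at hx
    obtain ⟨c, _, hc⟩ := hx
    exact ⟨c, sub_eq_zero.1 hc⟩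
  have hlt : ∀ b c, b < c → ∀ᶠ x in 𝓝 x₀, ψ c x < ψ b x := fun b c hbc => by
    refine (hψ c).continuousAt.eventually_lt (hψ b).continuousAt ?_
    rw [hψ0, hψ0]
    exact lt_of_le_of_ne (hl x₀ hbc.le) fun h => hbc.ne' (hinj h)
  -- The branches are continuous and strictly ordered at `x₀`, hence nearby; having n distinct
  -- roots, they exhaust the list.
  have hev : ∀ᶠ x in 𝓝 x₀, (fun b => ψ b x) = l x := by
    have h1 : ∀ᶠ x in 𝓝 x₀, ∀ b c, b < c → ψ c x < ψ b x :=
      eventually_all.2 fun b => eventually_all.2 fun c => by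
        by_cases h : b < c
        · filter_upwards [hlt b c h] with x hx _ using hx
        · exact Eventually.of_forall fun x h' => absurd h' h
    filter_upwards [h1, eventually_all.2 hroot] with x hx1 hx2
    exact strictAnti_eq_of_forall_exists (fun b c hbc => hx1 b c hbc) (hl x) hx2
  refine (hψ a).congr_of_eventuallyEq ?_
  filter_upwards [hev] with x hx
  exact (congrFun hx a).symm

end Eigenvalues

/-! ### Orthogonal conjugation and spectral projectors -/

section Orthogonal

variable {ι : Type*} [Fintype ι] [DecidableEq ι] {U : Matrix ι ι ℝ}

/-- The adjugate reverses products and adj U = (det U) Uᵀ; the two determinants multiply to 1. No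
inverse of d is needed, which matters since the application has a zero entry in d. -/
theorem adjugate_orthogonal_conj (hU : U ∈ Matrix.orthogonalGroup ι ℝ) (d : ι → ℝ) :
    (U * Matrix.diagonal d * U.transpose).adjugate =
      U * (Matrix.diagonal fun i => ∏ j ∈ Finset.univ.erase i, d j) * U.transpose := by
  have h1 : U * U.transpose = 1 := (Matrix.mem_orthogonalGroup_iff _ _).1 hU
  have h2 : U.transpose * U = 1 := (Matrix.mem_orthogonalGroup_iff' _ _).1 hU
  have hd : U.det * U.det = 1 := by
    have := congrArg Matrix.det h1
    rwa [Matrix.det_mul, Matrix.det_transpose, Matrix.det_one] at this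
  have ha : U.adjugate = U.det • U.transpose := by
    calc U.adjugate = U.adjugate * (U * U.transpose) := by rw [h1, mul_one]
      _ = _ := by rw [← mul_assoc, Matrix.adjugate_mul, Matrix.smul_mul, one_mul]
  have ha' : U.transpose.adjugate = U.det • U := by
    rw [← Matrix.adjugate_transpose, ha, Matrix.transpose_smul, Matrix.transpose_transpose]
  rw [Matrix.adjugate_mul_distrib, Matrix.adjugate_mul_distrib, ha, ha', Matrix.adjugate_diagonal]
  simp only [Matrix.smul_mul, Matrix.mul_smul, smul_smul, hd, one_smul, mul_assoc]

theorem sub_orthogonal_conj (hU : U ∈ Matrix.orthogonalGroup ι ℝ) (d : ι → ℝ) (t : ℝ) :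
    Matrix.diagonal (fun _ => t) - U * Matrix.diagonal d * U.transpose =
      U * Matrix.diagonal (fun i => t - d i) * U.transpose := by
  have h1 : U * U.transpose = 1 := (Matrix.mem_orthogonalGroup_iff _ _).1 hU
  have h3 : (Matrix.diagonal fun i => t - d i) = t • (1 : Matrix ι ι ℝ) - Matrix.diagonal d := by
    ext i j; by_cases h : i = j <;> simp [h]
  have h4 : (Matrix.diagonal fun _ : ι => t) = t • (1 : Matrix ι ι ℝ) := by
    ext i j; by_cases h : i = j <;> simp [h]
  rw [h3, h4, Matrix.mul_sub, Matrix.sub_mul, Matrix.mul_smul, Matrix.smul_mul, mul_one, h1]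

theorem det_orthogonal_conj (hU : U ∈ Matrix.orthogonalGroup ι ℝ) (d : ι → ℝ) :
    (U * Matrix.diagonal d * U.transpose).det = ∏ i, d i := by
  have h1 : U * U.transpose = 1 := (Matrix.mem_orthogonalGroup_iff _ _).1 hU
  have := congrArg Matrix.det h1
  rw [Matrix.det_mul, Matrix.det_one] at this
  rw [Matrix.det_mul, Matrix.det_mul, Matrix.det_diagonal, mul_right_comm, this, one_mul]

theorem orthogonal_conj_diagonal_apply (U : Matrix ι ι ℝ) (d : ι → ℝ) (i j : ι) :
    (U * Matrix.diagonal d * U.transpose) i j = ∑ a, d a * (U i a * U j a) := by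
  rw [Matrix.mul_apply]
  simp only [Matrix.mul_diagonal, Matrix.transpose_apply]
  exact Finset.sum_congr rfl fun a _ => by ring

/-- The spectral projector is a multiple of an adjugate matrix. -/
theorem mul_eq_adjugate_div (hU : U ∈ Matrix.orthogonalGroup ι ℝ) {d : ι → ℝ}
    (hd : Function.Injective d) (a i j : ι) :
    U i a * U j a = (Matrix.diagonal (fun _ => d a) -
      U * Matrix.diagonal d * U.transpose).adjugate i j /
        ∏ b ∈ Finset.univ.erase a, (d a - d b) := by
  have hc : ∏ b ∈ Finset.univ.erase a, (d a - d b) ≠ 0 :=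
    Finset.prod_ne_zero_iff.2 fun b hb =>
      sub_ne_zero.2 fun h => (Finset.mem_erase.1 hb).1 (hd h).symm
  -- With entries d_a − d_b, every product omitting an index other than a contains the zero factor
  -- at a, so a single rank one term remains.
  rw [sub_orthogonal_conj hU, adjugate_orthogonal_conj hU, orthogonal_conj_diagonal_apply,
    Finset.sum_eq_single a, mul_div_cancel_left₀ _ hc]
  · intro b _ hb
    rw [Finset.prod_eq_zero (Finset.mem_erase.2 ⟨Ne.symm hb, Finset.mem_univ a⟩) (sub_self _),
      zero_mul]
  · simp

end Orthogonal

/-! ### Tucker products and unfoldings -/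

section Tucker

variable {K : ℕ} {p : Fin K → ℕ}

theorem sum_prod_pi {f : ∀ k, Fin (p k) → ℝ} :
    ∑ j : ∀ k, Fin (p k), ∏ k, f k (j k) = ∏ k, ∑ a, f k a := by
  rw [Finset.prod_univ_sum, Fintype.piFinset_univ]

theorem tucker_tucker (A B : ModeMatrices p) (X : Tensor p) :
    tucker A (tucker B X) = tucker (fun k => A k * B k) X := by
  funext i
  simp only [tucker, Finset.mul_sum]
  rw [Finset.sum_comm]
  refine Finset.sum_congr rfl fun l _ => ?_
  simp only [← mul_assoc, ← Finset.sum_mul, ← Finset.prod_mul_distrib, Matrix.mul_apply]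
  rw [sum_prod_pi (f := fun k a => A k (i k) a * B k a (l k))]

theorem tucker_diagonal (d : ∀ k, Fin (p k) → ℝ) (X : Tensor p) (i : ∀ k, Fin (p k)) :
    tucker (fun k => Matrix.diagonal (d k)) X i = (∏ k, d k (i k)) * X i := by
  rw [tucker, Finset.sum_eq_single i]
  · simp
  · intro j _ hj
    obtain ⟨k, hk⟩ := Function.ne_iff.1 hj
    have h1 : Matrix.diagonal (d k) (i k) (j k) = 0 := Matrix.diagonal_apply_ne' _ hk
    rw [Finset.prod_eq_zero (Finset.mem_univ k) h1, zero_mul]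
  · simp

theorem tucker_one (X : Tensor p) : tucker (fun _ => 1) X = X := by
  funext i
  have := tucker_diagonal (fun _ _ => 1) X i
  simp only [Matrix.diagonal_one, Finset.prod_const_one, one_mul] at this
  exact this

theorem tucker_add (A : ModeMatrices p) (X Y : Tensor p) :
    tucker A (X + Y) = tucker A X + tucker A Y := by
  funext i
  simp [tucker, mul_add, Finset.sum_add_distrib]

theorem tucker_smul (A : ModeMatrices p) (c : ℝ) (X : Tensor p) :
    tucker A (c • X) = c • tucker A X := by
  funext i
  simp only [tucker, Pi.smul_apply, smul_eq_mul, Finset.mul_sum]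
  exact Finset.sum_congr rfl fun j _ => by ring

theorem tucker_tucker_transpose {U : ModeMatrices p}
    (hU : ∀ k, U k ∈ Matrix.orthogonalGroup (Fin (p k)) ℝ) (X : Tensor p) :
    tucker U (tucker (fun k => (U k).transpose) X) = X := by
  rw [tucker_tucker]
  simp only [fun k => (Matrix.mem_orthogonalGroup_iff _ _).1 (hU k)]
  exact tucker_one X

/-- The matrix on the right is the Kronecker product of the matrices in the other modes. -/
theorem unfold_tucker (k : Fin K) (A : ModeMatrices p) (X : Tensor p) :
    unfold k (tucker A X) = A k * unfold k X *
      (Matrix.of fun r q : ∀ l : {l : Fin K // l ≠ k}, Fin (p l) =>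
        ∏ l, A l.1 (r l) (q l)).transpose := by
  ext a r
  simp only [unfold, tucker, Matrix.mul_apply, Matrix.transpose_apply, Matrix.of_apply,
    Finset.sum_mul]
  rw [← (Equiv.piSplitAt k (fun l => Fin (p l))).symm.sum_comp, Fintype.sum_prod_type,
    Finset.sum_comm]
  refine Finset.sum_congr rfl fun q _ => Finset.sum_congr rfl fun c _ => ?_
  have h1 : ∏ l, A l ((Equiv.piSplitAt k (fun l => Fin (p l))).symm (a, r) l)
      ((Equiv.piSplitAt k (fun l => Fin (p l))).symm (c, q) l) =
      A k a c * ∏ l : {l : Fin K // l ≠ k}, A l.1 (r l) (q l) := by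
    rw [← Finset.mul_prod_erase Finset.univ _ (Finset.mem_univ k)]
    congr 1
    · simp
    · rw [← Finset.prod_subtype (p := fun l => l ≠ k) (Finset.univ.erase k) (by simp)
        (fun l => A l ((Equiv.piSplitAt k (fun l => Fin (p l))).symm (a, r) l)
          ((Equiv.piSplitAt k (fun l => Fin (p l))).symm (c, q) l)) |>.symm]
      refine Finset.prod_congr rfl fun l _ => ?_
      simp [l.2]
  rw [h1]; ring

/-- The Kronecker factor R of the remaining modes has orthonormal columns and cancels. Two arrays
are allowed, since derivatives of Gram matrices are mixed Gram products. -/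
theorem unfold_gram_tucker (k : Fin K) {U : ModeMatrices p}
    (hU : ∀ k, U k ∈ Matrix.orthogonalGroup (Fin (p k)) ℝ) (X Y : Tensor p) :
    unfold k (tucker U X) * (unfold k (tucker U Y)).transpose =
      U k * (unfold k X * (unfold k Y).transpose) * (U k).transpose := by
  rw [unfold_tucker, unfold_tucker]
  set R := Matrix.of fun r q : ∀ l : {l : Fin K // l ≠ k}, Fin (p l) => ∏ l, U l.1 (r l) (q l)
  have hR : R.transpose * R = 1 := by
    ext q q'
    simp only [R, Matrix.mul_apply, Matrix.transpose_apply, Matrix.of_apply,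
      ← Finset.prod_mul_distrib]
    rw [← Fintype.piFinset_univ, ← Finset.prod_univ_sum (fun _ => Finset.univ)
      (fun (l : {l : Fin K // l ≠ k}) a => U l.1 a (q l) * U l.1 a (q' l))]
    have h1 : ∀ l : {l : Fin K // l ≠ k}, ∑ a, U l.1 a (q l) * U l.1 a (q' l) =
        (1 : Matrix (Fin (p l)) (Fin (p l)) ℝ) (q l) (q' l) := fun l => by
      rw [← (Matrix.mem_orthogonalGroup_iff' _ _).1 (hU l.1), Matrix.mul_apply]; rfl
    simp only [h1]
    by_cases h : q = q'
    · subst h; simp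
    · obtain ⟨l, hl⟩ := Function.ne_iff.1 h
      have h2 : (1 : Matrix (Fin (p l)) (Fin (p l)) ℝ) (q l) (q' l) = 0 := Matrix.one_apply_ne hl
      exact (Finset.prod_eq_zero (Finset.mem_univ l) h2).trans (Matrix.one_apply_ne h).symm
  calc _ = U k * unfold k X * (R.transpose * R) * (unfold k Y).transpose * (U k).transpose := by
        simp only [Matrix.transpose_mul, Matrix.transpose_transpose, Matrix.mul_assoc]
    _ = _ := by rw [hR, Matrix.mul_one]; simp only [Matrix.mul_assoc]

/-- A unit array has one nonzero entry in its unfolding, so only row i_k survives; this makes the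
Gram derivative along U·e_i sparse. -/
theorem unfold_single_gram (k : Fin K) (i : ∀ k, Fin (p k)) (S : Tensor p) (b c : Fin (p k)) :
    (unfold k (Pi.single i 1) * (unfold k S).transpose) b c =
      if b = i k then S (Function.update i k c) else 0 := by
  rw [Matrix.mul_apply]
  simp only [Matrix.transpose_apply, unfold]
  by_cases hb : b = i k
  · subst hb
    rw [if_pos rfl, Finset.sum_eq_single (fun l : {l : Fin K // l ≠ k} => i l.1)]
    · have h1 : (Equiv.piSplitAt k (fun l => Fin (p l))).symm (i k, fun l => i l) = i :=
        (Equiv.piSplitAt k (fun l => Fin (p l))).symm_apply_apply i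
      have h2 : (Equiv.piSplitAt k (fun l => Fin (p l))).symm (c, fun l => i l) =
          Function.update i k c := by
        funext l
        by_cases hl : l = k
        · subst hl; simp
        · simp [hl]
      rw [h1, h2]; simp
    · intro r _ hr
      rw [Pi.single_eq_of_ne, zero_mul]
      intro h
      apply hr
      have := congrArg (Equiv.piSplitAt k (fun l => Fin (p l))) h
      rw [Equiv.apply_symm_apply] at this
      exact congrArg Prod.snd this
    · simp
  · rw [if_neg hb]
    refine Finset.sum_eq_zero fun r _ => ?_
    rw [Pi.single_eq_of_ne, zero_mul]
    rintro rfl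
    apply hb; simp

end Tucker

namespace HOSVD

variable {K : ℕ} {p : Fin K → ℕ} {X : Tensor p} (h : HOSVD X)

theorem gram_eq (k : Fin K) : unfold k X * (unfold k X).transpose =
    h.U k * Matrix.diagonal (fun a => h.σ k a ^ 2) * (h.U k).transpose := by
  rw [h.gram, Matrix.diagonal_pow]; rfl

theorem tucker_U_S : tucker h.U h.S = X := tucker_tucker_transpose h.orthogonal X

/-- All-orthogonality of the core array: its slices in each mode are orthogonal with squared norms
σ². -/
theorem gram_S (k : Fin K) : unfold k h.S * (unfold k h.S).transpose =
    Matrix.diagonal (fun a => h.σ k a ^ 2) := by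
  have h1 := unfold_gram_tucker k h.orthogonal h.S h.S
  rw [h.tucker_U_S, h.gram_eq] at h1
  have hU := (Matrix.mem_orthogonalGroup_iff' _ _).1 (h.orthogonal k)
  have h2 := congrArg (fun M => (h.U k).transpose * M * h.U k) h1
  simp only [Matrix.mul_assoc, hU, Matrix.mul_one] at h2
  simp only [← Matrix.mul_assoc, hU, Matrix.one_mul] at h2
  exact h2.symm

theorem sq_antitone (k : Fin K) : Antitone fun a => h.σ k a ^ 2 := fun _ _ hab =>
  pow_le_pow_left₀ (h.nonneg _ _) (h.antitone k hab) 2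

variable {h}

theorem Regular.sq_injective (hr : h.Regular) (k : Fin K) :
    Function.Injective fun a => h.σ k a ^ 2 := fun _ _ hab =>
  (hr k).2 ((pow_left_inj₀ (h.nonneg _ _) (h.nonneg _ _) two_ne_zero).1 hab)

theorem Regular.inv_D (hr : h.Regular) (k : Fin K) :
    (h.D k)⁻¹ = Matrix.diagonal fun a => (h.σ k a)⁻¹ := by
  refine Matrix.inv_eq_right_inv ?_
  rw [D, Matrix.diagonal_mul_diagonal, ← Matrix.diagonal_one]
  congr 1
  funext a
  exact mul_inv_cancel₀ ((hr k).1 a).ne'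

end HOSVD

/-! ### C¹ dependence on the array over the regular set -/

section Smoothness

variable {K : ℕ} {p : Fin K → ℕ} (H : ∀ X : Tensor p, HOSVD X) {X : Tensor p}

theorem contDiff_gram (k : Fin K) (a b : Fin (p k)) :
    ContDiff ℝ 1 fun X : Tensor p => (unfold k X * (unfold k X).transpose) a b := by
  simp only [Matrix.mul_apply, Matrix.transpose_apply, unfold]
  exact ContDiff.sum fun r _ => (contDiff_apply ℝ ℝ _).mul (contDiff_apply ℝ ℝ _)

variable {H}

theorem contDiffAt_sq_σ (hX : (H X).Regular) (k : Fin K) (a : Fin (p k)) :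
    ContDiffAt ℝ 1 (fun Y => (H Y).σ k a ^ 2) X := by
  refine contDiffAt_ordered_eigenvalues (M := fun Y => unfold k Y * (unfold k Y).transpose)
    (contDiff_gram k) (fun Y => (H Y).sq_antitone k) (fun Y t => ?_) (hX.sq_injective k) a
  rw [(H Y).gram_eq, sub_orthogonal_conj ((H Y).orthogonal k),
    det_orthogonal_conj ((H Y).orthogonal k)]

theorem contDiffAt_σ_apply (hX : (H X).Regular) (k : Fin K) (a : Fin (p k)) :
    ContDiffAt ℝ 1 (fun Y => (H Y).σ k a) X := by
  have h1 := (contDiffAt_sq_σ hX k a).sqrt (pow_pos ((hX k).1 a) 2).ne'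
  simpa only [Real.sqrt_sq ((H _).nonneg k a)] using h1

theorem contDiffAt_σ (hX : (H X).Regular) (k : Fin K) :
    ContDiffAt ℝ 1 (fun Y => (H Y).σ k) X :=
  contDiffAt_pi.2 fun a => contDiffAt_σ_apply hX k a

theorem eventually_regular (hX : (H X).Regular) : ∀ᶠ Y in 𝓝 X, (H Y).Regular := by
  refine eventually_all.2 fun k => ?_
  have h1 : ∀ᶠ Y in 𝓝 X, ∀ a, 0 < (H Y).σ k a := eventually_all.2 fun a =>
    (contDiffAt_σ_apply hX k a).continuousAt.eventually (lt_mem_nhds ((hX k).1 a))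
  have h2 : ∀ᶠ Y in 𝓝 X, ∀ a b, a ≠ b → (H Y).σ k a ≠ (H Y).σ k b := by
    refine eventually_all.2 fun a => eventually_all.2 fun b => ?_
    by_cases hab : a = b
    · exact Eventually.of_forall fun Y h => absurd hab h
    · have := ((contDiffAt_σ_apply hX k a).continuousAt.prodMk
        (contDiffAt_σ_apply hX k b).continuousAt).eventually
          ((isOpen_ne_fun continuous_fst continuous_snd).mem_nhds
            (fun h => hab ((hX k).2 h)))
      exact this.mono fun Y h _ => h
  filter_upwards [h1, h2] with Y hY1 hY2
  exact ⟨hY1, fun a b h => not_imp_not.1 (hY2 a b) h⟩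

theorem isOpen_regular : IsOpen {X | (H X).Regular} :=
  isOpen_iff_mem_nhds.2 fun _ hX => eventually_regular hX

/-- Single columns of U need not even be continuous, as their signs are arbitrary; these products
are sign-free and given by the adjugate formula at all nearby regular points. -/
theorem contDiffAt_proj (hX : (H X).Regular) (k : Fin K) (a i j : Fin (p k)) :
    ContDiffAt ℝ 1 (fun Y => (H Y).U k i a * (H Y).U k j a) X := by
  have hne : ∏ b ∈ Finset.univ.erase a, ((H X).σ k a ^ 2 - (H X).σ k b ^ 2) ≠ 0 :=
    Finset.prod_ne_zero_iff.2 fun b hb =>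
      sub_ne_zero.2 fun h => (Finset.mem_erase.1 hb).1 (hX.sq_injective k h).symm
  have h1 : ContDiffAt ℝ 1 (fun Y => (Matrix.diagonal (fun _ => (H Y).σ k a ^ 2) -
      unfold k Y * (unfold k Y).transpose).adjugate i j /
        ∏ b ∈ Finset.univ.erase a, ((H Y).σ k a ^ 2 - (H Y).σ k b ^ 2)) X := by
    refine (contDiffAt_adjugate (fun c d => ?_) i j).div
      (contDiffAt_prod fun b _ => (contDiffAt_sq_σ hX k a).sub (contDiffAt_sq_σ hX k b)) hne
    simp only [Matrix.sub_apply, Matrix.diagonal_apply]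
    refine ContDiffAt.sub ?_ (contDiff_gram k c d).contDiffAt
    split_ifs
    · exact contDiffAt_sq_σ hX k a
    · exact contDiffAt_const
  refine h1.congr_of_eventuallyEq ?_
  filter_upwards [eventually_regular hX] with Y hY
  rw [(H Y).gram_eq]
  exact mul_eq_adjugate_div ((H Y).orthogonal k) (hY.sq_injective k) a i j

/-- The rank one components of `X` in the singular bases, divided by the singular values. -/
def HOSVD.component (h : HOSVD X) (a i : ∀ k, Fin (p k)) : ℝ :=
  (∏ k, (h.σ k (a k))⁻¹) * ∑ j : ∀ k, Fin (p k), (∏ k, h.U k (i k) (a k) * h.U k (j k) (a k)) * X j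

theorem contDiffAt_component (hX : (H X).Regular) (a i : ∀ k, Fin (p k)) :
    ContDiffAt ℝ 1 (fun Y => (H Y).component a i) X := by
  refine (contDiffAt_prod fun k _ =>
    (contDiffAt_σ_apply hX k (a k)).inv ((hX k).1 (a k)).ne').mul ?_
  exact ContDiffAt.sum fun j _ => (contDiffAt_prod fun k _ => contDiffAt_proj hX k _ _ _).mul
    (contDiff_apply ℝ ℝ j).contDiffAt

theorem estimator_eq_tucker (hX : (H X).Regular) (g : ∀ k, (Fin (p k) → ℝ) → (Fin (p k) → ℝ)) :
    estimator H g X = tucker (fun k => (H X).U k *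
      Matrix.diagonal (fun a => g k ((H X).σ k) a * ((H X).σ k a)⁻¹) * ((H X).U k).transpose) X := by
  simp only [estimator, HOSVD.S, HOSVD.f, tucker_tucker, hX.inv_D]
  congr 1
  funext k
  rw [← Matrix.diagonal_mul_diagonal]
  simp only [Matrix.mul_assoc]

/-- Separates the factors that depend on g from coefficients that are C¹ whatever g is; both forms
of the theorem rest on this. -/
theorem estimator_eq_sum (hX : (H X).Regular) (g : ∀ k, (Fin (p k) → ℝ) → (Fin (p k) → ℝ))
    (i : ∀ k, Fin (p k)) :
    estimator H g X i =
      ∑ a : ∀ k, Fin (p k), (∏ k, g k ((H X).σ k) (a k)) * (H X).component a i := by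
  rw [estimator_eq_tucker hX, tucker]
  simp only [orthogonal_conj_diagonal_apply, HOSVD.component, Finset.mul_sum]
  rw [Finset.sum_comm]
  refine Finset.sum_congr rfl fun j _ => ?_
  rw [← sum_prod_pi (f := fun k b => g k ((H X).σ k) b * ((H X).σ k b)⁻¹ *
    ((H X).U k (i k) b * (H X).U k (j k) b)), Finset.sum_mul]
  refine Finset.sum_congr rfl fun a _ => ?_
  rw [Finset.prod_mul_distrib, Finset.prod_mul_distrib]
  ring

theorem differentiableAt_estimator (hX : (H X).Regular)
    {g : ∀ k, (Fin (p k) → ℝ) → (Fin (p k) → ℝ)}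
    (hg : ∀ k, DifferentiableAt ℝ (g k) ((H X).σ k)) :
    DifferentiableAt ℝ (estimator H g) X := by
  refine differentiableAt_pi.2 fun i => ?_
  have h1 : ∀ k b, DifferentiableAt ℝ (fun Y => g k ((H Y).σ k) b) X := fun k b =>
    differentiableAt_pi.1 ((hg k).comp X ((contDiffAt_σ hX k).differentiableAt one_ne_zero)) b
  have h2 : DifferentiableAt ℝ (fun Y => ∑ a : ∀ k, Fin (p k), (∏ k, g k ((H Y).σ k) (a k)) *
      (H Y).component a i) X := by
    refine DifferentiableAt.fun_sum fun a _ => DifferentiableAt.mul ?_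
      ((contDiffAt_component hX a i).differentiableAt one_ne_zero)
    exact (HasFDerivAt.finsetProd fun k _ => (h1 k (a k)).hasFDerivAt).differentiableAt
  refine h2.congr_of_eventuallyEq ?_
  filter_upwards [eventually_regular hX] with Y hY
  exact estimator_eq_sum hY g i

end Smoothness

/-! ### Derivatives of spectral functions in a moving frame -/

section MatrixCurves

variable {ι : Type*} [Fintype ι] [DecidableEq ι]

/-- A curve of matrices has the entrywise derivative `A'` at `0`. -/
def HasEntryDeriv (A : ℝ → Matrix ι ι ℝ) (A' : Matrix ι ι ℝ) : Prop :=
  ∀ i j, HasDerivAt (fun r => A r i j) (A' i j) 0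

variable {A B : ℝ → Matrix ι ι ℝ} {A' B' : Matrix ι ι ℝ}

omit [Fintype ι] [DecidableEq ι] in
theorem HasEntryDeriv.unique (hA : HasEntryDeriv A A') (hB : HasEntryDeriv B B')
    (h : ∀ᶠ r in 𝓝 (0 : ℝ), A r = B r) : A' = B' := by
  ext i j
  refine (hA i j).unique ((hB i j).congr_of_eventuallyEq ?_)
  filter_upwards [h] with r hr
  rw [hr]

omit [DecidableEq ι] in
theorem HasEntryDeriv.mul (hA : HasEntryDeriv A A') (hB : HasEntryDeriv B B') :
    HasEntryDeriv (fun r => A r * B r) (A' * B 0 + A 0 * B') := by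
  intro i j
  simp only [Matrix.mul_apply, Matrix.add_apply, ← Finset.sum_add_distrib]
  exact HasDerivAt.fun_sum fun k _ => (hA i k).mul (hB k j)

/-- The conjugate of a diagonal matrix along a curve of orthogonal matrices. -/
def conjDiag (U : ℝ → Matrix ι ι ℝ) (w : ℝ → ι → ℝ) (r : ℝ) : Matrix ι ι ℝ :=
  U r * Matrix.diagonal (w r) * (U r).transpose

variable {U : ℝ → Matrix ι ι ℝ}

theorem conjDiag_mul (hU : ∀ r, U r ∈ Matrix.orthogonalGroup ι ℝ) (w v : ℝ → ι → ℝ) (r : ℝ) :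
    conjDiag U w r * conjDiag U v r = conjDiag U (fun r a => w r a * v r a) r := by
  have h2 := (Matrix.mem_orthogonalGroup_iff' _ _).1 (hU r)
  calc _ = U r * Matrix.diagonal (w r) * ((U r).transpose * U r) * Matrix.diagonal (v r) *
        (U r).transpose := by simp only [conjDiag, Matrix.mul_assoc]
    _ = _ := by
        rw [h2, Matrix.mul_one, Matrix.mul_assoc (U r), Matrix.diagonal_mul_diagonal]; rfl

theorem transpose_mul_conjDiag_mul (hU : ∀ r, U r ∈ Matrix.orthogonalGroup ι ℝ) (w : ℝ → ι → ℝ)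
    (r : ℝ) : (U r).transpose * conjDiag U w r * U r = Matrix.diagonal (w r) := by
  have h2 := (Matrix.mem_orthogonalGroup_iff' _ _).1 (hU r)
  calc _ = (U r).transpose * U r * Matrix.diagonal (w r) * ((U r).transpose * U r) := by
        simp only [conjDiag, Matrix.mul_assoc]
    _ = _ := by rw [h2, Matrix.mul_one, Matrix.one_mul]

theorem transpose_mul_mul_mul (hU : ∀ r, U r ∈ Matrix.orthogonalGroup ι ℝ) (M N : Matrix ι ι ℝ) :
    (U 0).transpose * (M * N) * U 0 =
      ((U 0).transpose * M * U 0) * ((U 0).transpose * N * U 0) := by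
  have h1 := (Matrix.mem_orthogonalGroup_iff _ _).1 (hU 0)
  calc _ = (U 0).transpose * M * (U 0 * (U 0).transpose) * N * U 0 := by
        rw [h1]; simp only [Matrix.mul_assoc, Matrix.mul_one]
    _ = _ := by simp only [Matrix.mul_assoc]

/-- In the moving frame, the off-diagonal part of the derivative of a spectral function. -/
theorem conj_deriv_commute (hU : ∀ r, U r ∈ Matrix.orthogonalGroup ι ℝ) {w v : ℝ → ι → ℝ}
    {W V : Matrix ι ι ℝ} (hw : HasEntryDeriv (conjDiag U w) W)
    (hv : HasEntryDeriv (conjDiag U v) V) (b c : ι) :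
    ((U 0).transpose * W * U 0) b c * (v 0 b - v 0 c) =
      (w 0 b - w 0 c) * ((U 0).transpose * V * U 0) b c := by
  -- Spectral functions in a common frame commute for every r, so both orders of the product have
  -- the same derivative.
  have h1 := (hw.mul hv).unique (hv.mul hw) (Eventually.of_forall fun r => by
    rw [conjDiag_mul hU, conjDiag_mul hU]; simp only [mul_comm])
  have h2 := congrArg (fun M => ((U 0).transpose * M * U 0) b c) h1
  simp only [Matrix.mul_add, Matrix.add_mul, transpose_mul_mul_mul hU,
    transpose_mul_conjDiag_mul hU, Matrix.add_apply, Matrix.mul_diagonal,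
    Matrix.diagonal_mul] at h2
  linarith

/-- In the moving frame, the derivatives of the spectral projectors have zero diagonal. -/
theorem conj_deriv_proj_diag (hU : ∀ r, U r ∈ Matrix.orthogonalGroup ι ℝ) (a : ι)
    {P' : Matrix ι ι ℝ} (hP : HasEntryDeriv (conjDiag U fun _ => Pi.single a 1) P') (c : ι) :
    ((U 0).transpose * P' * U 0) c c = 0 := by
  -- Differentiating P² = P: on the diagonal in the frame, an entry x satisfies 2x = x in position a
  -- and 0 = x elsewhere.
  have h1 := (hP.mul hP).unique hP (Eventually.of_forall fun r => by
    rw [conjDiag_mul hU]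
    congr 1
    funext _ b
    by_cases hb : b = a <;> simp [hb])
  have h2 := congrArg (fun M => ((U 0).transpose * M * U 0) c c) h1
  simp only [Matrix.mul_add, Matrix.add_mul, transpose_mul_mul_mul hU,
    transpose_mul_conjDiag_mul hU, Matrix.add_apply, Matrix.mul_diagonal,
    Matrix.diagonal_mul] at h2
  by_cases hc : c = a
  · simp only [hc, Pi.single_eq_same, mul_one, one_mul] at h2
    rw [hc]; linarith
  · simpa [Pi.single_apply, hc] using h2.symm

theorem conjDiag_apply (w : ℝ → ι → ℝ) (r : ℝ) (i j : ι) :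
    conjDiag U w r i j = ∑ a, w r a * conjDiag U (fun _ => Pi.single a 1) r i j := by
  simp only [conjDiag, orthogonal_conj_diagonal_apply]
  refine Finset.sum_congr rfl fun a _ => ?_
  rw [Finset.sum_eq_single a]
  · simp
  · intro b _ hb; simp [hb]
  · simp

/-- Spectral functions are differentiable where the spectral projectors are; in the moving frame
the diagonal of the derivative is the derivative of the eigenvalues. -/
theorem exists_conj_deriv (hU : ∀ r, U r ∈ Matrix.orthogonalGroup ι ℝ)
    (hP : ∀ a, ∃ P', HasEntryDeriv (conjDiag U fun _ => Pi.single a 1) P')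
    {w : ℝ → ι → ℝ} {w' : ι → ℝ} (hw : ∀ a, HasDerivAt (fun r => w r a) (w' a) 0) :
    ∃ W, HasEntryDeriv (conjDiag U w) W ∧ ∀ c, ((U 0).transpose * W * U 0) c c = w' c := by
  choose P' hP' using hP
  refine ⟨∑ a, (w' a • conjDiag U (fun _ => Pi.single a 1) 0 + w 0 a • P' a), ?_, fun c => ?_⟩
  · intro i j
    simp only [conjDiag_apply w, Matrix.sum_apply, Matrix.add_apply, Matrix.smul_apply, smul_eq_mul]
    exact HasDerivAt.fun_sum fun a _ => (hw a).mul (hP' a i j)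
  · simp only [Matrix.mul_sum, Matrix.sum_mul, Matrix.sum_apply, Matrix.mul_add, Matrix.add_mul,
      Matrix.mul_smul, Matrix.smul_mul, Matrix.add_apply, Matrix.smul_apply,
      transpose_mul_conjDiag_mul hU, conj_deriv_proj_diag hU _ (hP' _), smul_eq_mul, mul_zero,
      add_zero]
    rw [Finset.sum_eq_single c]
    · simp
    · intro b _ hb; simp [hb]
    · simp

end MatrixCurves

/-! ### Product rule for Tucker products; trace in a rotated basis -/

section TuckerCurves

variable {K : ℕ} {p : Fin K → ℕ}

/-- Diagonal factors force the summation index to agree with i outside mode k. -/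
theorem tucker_update_diagonal (d : ∀ k, Fin (p k) → ℝ) (k : Fin K)
    (N : Matrix (Fin (p k)) (Fin (p k)) ℝ) (S : Tensor p) (i : ∀ k, Fin (p k)) :
    tucker (Function.update (fun l => Matrix.diagonal (d l)) k N) S i =
      (∏ l ∈ Finset.univ.erase k, d l (i l)) * ∑ c, N (i k) c * S (Function.update i k c) := by
  rw [tucker, Finset.mul_sum]
  symm
  refine Finset.sum_of_injOn (fun c => Function.update i k c)
    (fun a _ b _ hab => Function.update_injective i k hab) (fun _ _ => Finset.mem_coe.2
      (Finset.mem_univ _)) (fun j _ hj => ?_) (fun c _ => ?_)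
  · have : ∃ l, l ≠ k ∧ i l ≠ j l := by
      by_contra! hne
      refine hj ⟨j k, by simp, ?_⟩
      funext l
      by_cases hl : l = k
      · subst hl; simp
      · simp [hl, hne l hl]
    obtain ⟨l, hlk, hl⟩ := this
    have h0 : (Function.update (fun l => Matrix.diagonal (d l)) k N) l (i l) (j l) = 0 := by
      rw [Function.update_of_ne hlk]; exact Matrix.diagonal_apply_ne _ hl
    rw [Finset.prod_eq_zero (Finset.mem_univ l) h0, zero_mul]
  · rw [← Finset.mul_prod_erase Finset.univ _ (Finset.mem_univ k), Function.update_self,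
      Function.update_self]
    rw [Finset.prod_congr rfl fun l hl => ?_]
    · ring
    · have hlk := (Finset.mem_erase.1 hl).1
      rw [Function.update_of_ne hlk, Function.update_of_ne hlk, Matrix.diagonal_apply_eq]

theorem hasDerivAt_tucker {B : ℝ → ModeMatrices p} {B' : ModeMatrices p}
    (hB : ∀ k, HasEntryDeriv (fun r => B r k) (B' k)) (X Z : Tensor p) (i : ∀ k, Fin (p k)) :
    HasDerivAt (fun r => tucker (B r) (X + r • Z) i)
      (∑ k, tucker (Function.update (B 0) k (B' k)) X i + tucker (B 0) Z i) 0 := by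
  have h1 : ∀ j, HasDerivAt (fun r : ℝ => (X + r • Z) j) (Z j) 0 := fun j => by
    simpa using ((hasDerivAt_id (0 : ℝ)).mul_const (Z j)).const_add (X j)
  have h2 := HasDerivAt.fun_sum (u := Finset.univ) fun (j : ∀ k, Fin (p k)) _ =>
    (HasDerivAt.fun_finsetProd (u := Finset.univ) fun k _ => hB k (i k) (j k)).mul (h1 j)
  refine h2.congr_deriv ?_
  simp only [tucker]
  rw [Finset.sum_comm, ← Finset.sum_add_distrib]
  refine Finset.sum_congr rfl fun j _ => ?_
  simp only [zero_smul, add_zero, Finset.sum_mul]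
  congr 1
  refine Finset.sum_congr rfl fun k _ => ?_
  congr 1
  rw [← Finset.mul_prod_erase Finset.univ _ (Finset.mem_univ k), Function.update_self, smul_eq_mul,
    mul_comm]
  congr 1
  exact Finset.prod_congr rfl fun l hl => by rw [Function.update_of_ne (Finset.mem_erase.1 hl).1]

/-- The map (i, c) ↦ (i with c in mode k, i_k) is an involution of the index pairs. -/
theorem sum_update_swap (k : Fin K) (F : (∀ k, Fin (p k)) → Fin (p k) → ℝ) :
    ∑ i, ∑ c ∈ Finset.univ.erase (i k), F i c =
      ∑ i, ∑ m ∈ Finset.univ.erase (i k), F (Function.update i k m) (i k) := by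
  rw [Finset.sum_sigma', Finset.sum_sigma']
  refine Finset.sum_nbij' (fun q => ⟨Function.update q.1 k q.2, q.1 k⟩)
    (fun q => ⟨Function.update q.1 k q.2, q.1 k⟩) ?_ ?_ ?_ ?_ ?_
  · rintro ⟨i, c⟩ h; simpa using (by simpa using h : c ≠ i k).symm
  · rintro ⟨i, c⟩ h; simpa using (by simpa using h : c ≠ i k).symm
  · rintro ⟨i, c⟩ _; simp
  · rintro ⟨i, c⟩ _; simp
  · rintro ⟨i, c⟩ _; simp

/-- Cyclicity of the trace. At each point it permits the basis adapted to the singular vectors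
there. -/
theorem divergence_eq_sum_conj {U : ModeMatrices p}
    (hU : ∀ k, U k ∈ Matrix.orthogonalGroup (Fin (p k)) ℝ) (u : Tensor p → Tensor p)
    (X : Tensor p) :
    divergence u X = ∑ i, tucker (fun k => (U k).transpose)
      (fderiv ℝ u X (tucker U (Pi.single i 1))) i := by
  let lin : ModeMatrices p → Tensor p →ₗ[ℝ] Tensor p := fun A =>
    { toFun := tucker A, map_add' := tucker_add A, map_smul' := tucker_smul A }
  have htr : ∀ L : Tensor p →ₗ[ℝ] Tensor p, ∑ i, L (Pi.single i 1) i = LinearMap.trace ℝ _ L := by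
    intro L
    rw [LinearMap.trace_eq_matrix_trace ℝ (Pi.basisFun ℝ _)]
    simp [Matrix.trace]
  have h1 : lin U ∘ₗ lin (fun k => (U k).transpose) = LinearMap.id :=
    LinearMap.ext fun Y => tucker_tucker_transpose hU Y
  have h2 := htr (lin (fun k => (U k).transpose) ∘ₗ ((fderiv ℝ u X : _ →ₗ[ℝ] _) ∘ₗ lin U))
  rw [LinearMap.trace_comp_comm', LinearMap.comp_assoc, h1, LinearMap.comp_id, ← htr] at h2
  exact h2.symm

end TuckerCurves

/-! ### First variations of the singular values and weights -/

section Divergence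

variable {K : ℕ} {p : Fin K → ℕ} {H : ∀ X : Tensor p, HOSVD X} {X : Tensor p}

theorem tucker_finsetSum {τ : Type*} (A : ModeMatrices p) (s : Finset τ) (Y : τ → Tensor p) :
    tucker A (∑ t ∈ s, Y t) = ∑ t ∈ s, tucker A (Y t) := by
  funext i
  simp only [tucker, Finset.sum_apply, Finset.mul_sum]
  exact Finset.sum_comm

theorem hasDerivAt_line {F : Tensor p → ℝ} (hF : DifferentiableAt ℝ F X) (Z : Tensor p) :
    HasDerivAt (fun r : ℝ => F (X + r • Z)) (fderiv ℝ F X Z) 0 :=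
  hF.hasFDerivAt.hasLineDerivAt Z

theorem hasEntryDeriv_gram (k : Fin K) (Z : Tensor p) :
    HasEntryDeriv (fun r : ℝ => unfold k (X + r • Z) * (unfold k (X + r • Z)).transpose)
      (unfold k Z * (unfold k X).transpose + unfold k X * (unfold k Z).transpose) := by
  intro i j
  have h1 : ∀ i c, HasDerivAt (fun r : ℝ => unfold k (X + r • Z) i c) (unfold k Z i c) 0 :=
    fun i c => by
      have := ((hasDerivAt_id (0 : ℝ)).mul_const (unfold k Z i c)).const_add (unfold k X i c)
      rw [one_mul] at this
      exact this
  simp only [Matrix.mul_apply, Matrix.add_apply, Matrix.transpose_apply, ← Finset.sum_add_distrib]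
  refine (HasDerivAt.fun_sum fun c _ => (h1 i c).mul (h1 j c)).congr_deriv ?_
  simp

theorem hasEntryDeriv_proj (hX : (H X).Regular) (k : Fin K) (Z : Tensor p) (a : Fin (p k)) :
    ∃ P', HasEntryDeriv
      (conjDiag (fun r : ℝ => (H (X + r • Z)).U k) fun _ => Pi.single a 1) P' := by
  refine ⟨Matrix.of fun i j => fderiv ℝ (fun Y => (H Y).U k i a * (H Y).U k j a) X Z,
    fun i j => ?_⟩
  have h1 := hasDerivAt_line ((contDiffAt_proj hX k a i j).differentiableAt one_ne_zero) Z
  refine h1.congr_of_eventuallyEq (Eventually.of_forall fun r => ?_)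
  simp only [conjDiag, orthogonal_conj_diagonal_apply]
  rw [Finset.sum_eq_single a]
  · simp
  · intro b _ hb; simp [hb]
  · simp

/-- Since X = U·S, the mixed Gram products along U·Y are conjugates by U_k of those of Y with the
core. -/
theorem conj_gram_deriv (k : Fin K) (Y : Tensor p) :
    ((H X).U k).transpose * (unfold k (tucker (H X).U Y) * (unfold k X).transpose +
      unfold k X * (unfold k (tucker (H X).U Y)).transpose) * (H X).U k =
      unfold k Y * (unfold k (H X).S).transpose +
        (unfold k Y * (unfold k (H X).S).transpose).transpose := by
  have hU := (Matrix.mem_orthogonalGroup_iff' _ _).1 ((H X).orthogonal k)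
  have h1 := unfold_gram_tucker k (H X).orthogonal Y (H X).S
  have h2 := unfold_gram_tucker k (H X).orthogonal (H X).S Y
  rw [(H X).tucker_U_S] at h1 h2
  have h3 : ∀ N : Matrix (Fin (p k)) (Fin (p k)) ℝ,
      ((H X).U k).transpose * ((H X).U k * N * ((H X).U k).transpose) * (H X).U k = N := by
    intro N
    calc _ = ((H X).U k).transpose * (H X).U k * N * (((H X).U k).transpose * (H X).U k) := by
          simp only [Matrix.mul_assoc]
      _ = N := by rw [hU, Matrix.mul_one, Matrix.one_mul]
  rw [h1, h2, Matrix.mul_add, Matrix.add_mul, h3, h3, Matrix.transpose_mul,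
    Matrix.transpose_transpose]

/-- The derivative of a spectral function of a mode Gram matrix in the frame of the singular
vectors. -/
theorem exists_conj_deriv_spectral (hX : (H X).Regular) (k : Fin K) (Y : Tensor p)
    {w : Tensor p → Fin (p k) → ℝ} (hw : ∀ a, DifferentiableAt ℝ (fun Z => w Z a) X) :
    ∃ W, HasEntryDeriv (conjDiag (fun r : ℝ => (H (X + r • tucker (H X).U Y)).U k)
        fun r => w (X + r • tucker (H X).U Y)) W ∧
      (∀ c, (((H X).U k).transpose * W * (H X).U k) c c =
        fderiv ℝ (fun Z => w Z c) X (tucker (H X).U Y)) ∧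
      ∀ b c, (((H X).U k).transpose * W * (H X).U k) b c * ((H X).σ k b ^ 2 - (H X).σ k c ^ 2) =
        (w X b - w X c) * ((unfold k Y * (unfold k (H X).S).transpose) b c +
          (unfold k Y * (unfold k (H X).S).transpose) c b) := by
  have hU : ∀ r : ℝ, (fun r : ℝ => (H (X + r • tucker (H X).U Y)).U k) r ∈
      Matrix.orthogonalGroup (Fin (p k)) ℝ := fun r => (H _).orthogonal k
  obtain ⟨W, hW, hd⟩ := exists_conj_deriv hU (hasEntryDeriv_proj hX k _)
    fun a => hasDerivAt_line (hw a) (tucker (H X).U Y)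
  -- The Gram matrix is itself a spectral function in the same frame, with eigenvalues σ², so the
  -- commutation identity applies to the pair.
  have hM : HasEntryDeriv (conjDiag (fun r : ℝ => (H (X + r • tucker (H X).U Y)).U k)
      fun r a => (H (X + r • tucker (H X).U Y)).σ k a ^ 2)
      (unfold k (tucker (H X).U Y) * (unfold k X).transpose +
        unfold k X * (unfold k (tucker (H X).U Y)).transpose) := by
    convert! hasEntryDeriv_gram (X := X) k (tucker (H X).U Y) using 2 with r
    exact ((H _).gram_eq k).symm
  have ho := conj_deriv_commute hU hW hM
  have h0 : X + (0 : ℝ) • tucker (H X).U Y = X := by rw [zero_smul, add_zero]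
  rw [h0] at hd ho
  refine ⟨W, hW, hd, fun b c => ?_⟩
  rw [ho b c, conj_gram_deriv]
  rfl

/-- The diagonal of the Gram derivative in the frame is the derivative of σ², namely 2σσ'; it also
equals twice a diagonal entry of the mixed Gram product. -/
theorem fderiv_σ_apply (hX : (H X).Regular) (k : Fin K) (Y : Tensor p) (a : Fin (p k)) :
    fderiv ℝ (fun Z => (H Z).σ k a) X (tucker (H X).U Y) =
      (unfold k Y * (unfold k (H X).S).transpose) a a / (H X).σ k a := by
  have hσ := (contDiffAt_σ_apply hX k a).differentiableAt one_ne_zero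
  have hU : ∀ r : ℝ, (fun r : ℝ => (H (X + r • tucker (H X).U Y)).U k) r ∈
      Matrix.orthogonalGroup (Fin (p k)) ℝ := fun r => (H _).orthogonal k
  obtain ⟨W, hW, hd⟩ := exists_conj_deriv hU (hasEntryDeriv_proj hX k _)
    fun a => hasDerivAt_line ((contDiffAt_sq_σ hX k a).differentiableAt one_ne_zero)
      (tucker (H X).U Y)
  have hM := hW.unique (hasEntryDeriv_gram (X := X) k (tucker (H X).U Y))
    (Eventually.of_forall fun r => ((H _).gram_eq k).symm)
  have h1 := hd a
  have h0 : X + (0 : ℝ) • tucker (H X).U Y = X := by rw [zero_smul, add_zero]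
  rw [h0] at h1
  rw [hM, conj_gram_deriv, Matrix.add_apply, Matrix.transpose_apply] at h1
  have h2 : fderiv ℝ (fun Z => (H Z).σ k a ^ 2) X (tucker (H X).U Y) =
      2 * (H X).σ k a * fderiv ℝ (fun Z => (H Z).σ k a) X (tucker (H X).U Y) := by
    have h3 := (hasDerivAt_line hσ (tucker (H X).U Y)).pow 2
    have h4 := hasDerivAt_line ((contDiffAt_sq_σ hX k a).differentiableAt one_ne_zero)
      (tucker (H X).U Y)
    rw [h4.unique h3, h0]
    simp
  rw [h2] at h1
  rw [eq_div_iff ((hX k).1 a).ne']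
  linarith

/-- Along U·e_i the derivative of σ^k is a multiple of the i_k-th basis vector, so of the Jacobian
of g only the diagonal entry at i_k is seen. -/
theorem fderiv_weight (hX : (H X).Regular) (k : Fin K) {g : (Fin (p k) → ℝ) → (Fin (p k) → ℝ)}
    (hg : DifferentiableAt ℝ g ((H X).σ k)) (i : ∀ k, Fin (p k)) :
    DifferentiableAt ℝ (fun Z => g ((H Z).σ k) (i k) * ((H Z).σ k (i k))⁻¹) X ∧
    fderiv ℝ (fun Z => g ((H Z).σ k) (i k) * ((H Z).σ k (i k))⁻¹) X
        (tucker (H X).U (Pi.single i 1)) =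
      (jacobian g ((H X).σ k) (i k) (i k) - g ((H X).σ k) (i k) * ((H X).σ k (i k))⁻¹) *
        ((H X).σ k (i k) ^ 2)⁻¹ * (H X).S i := by
  set Z₀ := tucker (H X).U (Pi.single i 1)
  have hpos := (hX k).1 (i k)
  have hσ := (contDiffAt_σ_apply hX k (i k)).differentiableAt one_ne_zero
  have hσ' := (contDiffAt_σ hX k).differentiableAt one_ne_zero
  have h1 : ∀ a, fderiv ℝ (fun Z => (H Z).σ k a) X Z₀ =
      if a = i k then (H X).S i / (H X).σ k (i k) else 0 := by
    intro a
    rw [fderiv_σ_apply hX, unfold_single_gram]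
    split_ifs with h
    · subst h; rw [Function.update_eq_self]
    · rw [zero_div]
  have h2 : fderiv ℝ (fun Z => (H Z).σ k) X Z₀ =
      ((H X).S i / (H X).σ k (i k)) • (Pi.single (i k) 1 : Fin (p k) → ℝ) := by
    funext a
    have h3 : fderiv ℝ (fun Z => (H Z).σ k) X Z₀ a = fderiv ℝ (fun Z => (H Z).σ k a) X Z₀ := by
      have := ((hasFDerivAt_pi'.1 hσ'.hasFDerivAt) a).fderiv
      rw [this]; rfl
    rw [h3, h1]
    by_cases h : a = i k <;> simp [h]
  have hgc : HasFDerivAt (fun Z => g ((H Z).σ k)) _ X := hg.hasFDerivAt.comp X hσ'.hasFDerivAt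
  have hgi := (hasFDerivAt_pi'.1 hgc) (i k)
  have hd := hgi.mul ((hasDerivAt_inv hpos.ne').comp_hasFDerivAt X hσ.hasFDerivAt)
  have hdiff : DifferentiableAt ℝ (fun Z => g ((H Z).σ k) (i k) * ((H Z).σ k (i k))⁻¹) X :=
    hgi.differentiableAt.mul (hσ.inv hpos.ne')
  refine ⟨hdiff, (congrArg (fun L : Tensor p →L[ℝ] ℝ => L Z₀) hd.fderiv).trans ?_⟩
  have h5 : (fderiv ℝ g ((H X).σ k)) (fderiv ℝ (fun Z => (H Z).σ k) X Z₀) (i k) =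
      (H X).S i / (H X).σ k (i k) * jacobian g ((H X).σ k) (i k) (i k) := by
    rw [h2, map_smul]; rfl
  simp only [_root_.add_apply, _root_.smul_apply, ContinuousLinearMap.comp_apply,
    ContinuousLinearMap.proj_apply, h5, h1, if_true, smul_eq_mul, Function.comp_apply]
  field_simp
  ring

end Divergence

/-! ### Assembling the divergence -/

section DivergenceFormula

variable {K : ℕ} {p : Fin K → ℕ} {H : ∀ X : Tensor p, HOSVD X} {X : Tensor p}
  {g : ∀ k, (Fin (p k) → ℝ) → (Fin (p k) → ℝ)}

/-- The diagonal entries `gᵏ(sₖ) / sₖ` of `fᵏ(Dₖ) Dₖ⁻¹`. -/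
def HOSVD.weight (h : HOSVD X) (g : ∀ k, (Fin (p k) → ℝ) → (Fin (p k) → ℝ)) (k : Fin K)
    (a : Fin (p k)) : ℝ :=
  g k (h.σ k) a * (h.σ k a)⁻¹

/-- Product rule over the modes, read in the frame: entry c = i_k of W'_k contributes the weight
derivative, entries c ≠ i_k contribute divided differences, and the explicit X contributes the last
product. -/
theorem conj_fderiv_estimator_apply (hX : (H X).Regular)
    (hg : ∀ k, DifferentiableAt ℝ (g k) ((H X).σ k)) (i : ∀ k, Fin (p k)) :
    tucker (fun k => ((H X).U k).transpose)
        (fderiv ℝ (estimator H g) X (tucker (H X).U (Pi.single i 1))) i =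
      ∑ k, (∏ l ∈ Finset.univ.erase k, (H X).weight g l (i l)) *
        ((jacobian (g k) ((H X).σ k) (i k) (i k) - (H X).weight g k (i k)) *
          ((H X).σ k (i k) ^ 2)⁻¹ * (H X).S i ^ 2 +
        ∑ c ∈ Finset.univ.erase (i k), ((H X).weight g k (i k) - (H X).weight g k c) /
          ((H X).σ k (i k) ^ 2 - (H X).σ k c ^ 2) * (H X).S (Function.update i k c) ^ 2) +
      ∏ k, (H X).weight g k (i k) := by
  set Z := tucker (H X).U (Pi.single i 1)
  have hw : ∀ k a, DifferentiableAt ℝ (fun Y => (H Y).weight g k a) X := fun k a => by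
    have := (fderiv_weight hX k (hg k) (Function.update i k a)).1
    rwa [Function.update_self] at this
  choose W hW hdiag hoff using fun k =>
    exists_conj_deriv_spectral hX k (Pi.single i 1) (w := fun Y => (H Y).weight g k) (hw k)
  have h0 : X + (0 : ℝ) • Z = X := by rw [zero_smul, add_zero]
  set B : ℝ → ModeMatrices p := fun r k => conjDiag (fun r : ℝ => (H (X + r • Z)).U k)
    (fun r => (H (X + r • Z)).weight g k) r
  have hB0 : ∀ k, B 0 k = (H X).U k * Matrix.diagonal ((H X).weight g k) *
      ((H X).U k).transpose := fun k => by simp only [B, conjDiag]; rw [h0]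
  have hline : ∀ᶠ r in 𝓝 (0 : ℝ), (H (X + r • Z)).Regular := by
    have hc : Tendsto (fun r : ℝ => X + r • Z) (𝓝 0) (𝓝 X) := by
      have : Continuous fun r : ℝ => X + r • Z := by fun_prop
      simpa only [h0] using this.tendsto 0
    exact hc.eventually (eventually_regular hX)
  have hfd : fderiv ℝ (estimator H g) X Z =
      ∑ k, tucker (Function.update (B 0) k (W k)) X + tucker (B 0) Z := by
    funext i'
    have h1 := hasDerivAt_tucker (B := B) hW X Z i'
    have h2 := ((hasFDerivAt_pi'.1 (differentiableAt_estimator hX hg).hasFDerivAt)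
      i').hasLineDerivAt Z
    have h3 : HasDerivAt (fun r : ℝ => estimator H g (X + r • Z) i') _ 0 := h2
    have h4 := h3.unique (h1.congr_of_eventuallyEq (hline.mono fun r hr =>
      congrFun (estimator_eq_tucker hr g) i'))
    rw [Pi.add_apply, Finset.sum_apply]
    exact h4
  have hU := fun k => (Matrix.mem_orthogonalGroup_iff' _ _).1 ((H X).orthogonal k)
  have hconj : ∀ k, ((H X).U k).transpose * B 0 k * (H X).U k =
      Matrix.diagonal ((H X).weight g k) := fun k => by
    rw [hB0]
    calc _ = ((H X).U k).transpose * (H X).U k * Matrix.diagonal ((H X).weight g k) *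
          (((H X).U k).transpose * (H X).U k) := by simp only [Matrix.mul_assoc]
      _ = _ := by rw [hU, Matrix.mul_one, Matrix.one_mul]
  have hk : ∀ k, tucker (fun k => ((H X).U k).transpose)
      (tucker (Function.update (B 0) k (W k)) X) =
      tucker (Function.update (fun l => Matrix.diagonal ((H X).weight g l)) k
        (((H X).U k).transpose * W k * (H X).U k)) (H X).S := fun k => by
    have h1 : tucker (Function.update (B 0) k (W k)) X =
        tucker (Function.update (B 0) k (W k)) (tucker (H X).U (H X).S) := by rw [(H X).tucker_U_S]
    rw [h1, tucker_tucker, tucker_tucker]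
    congr 1
    funext l
    by_cases hl : l = k
    · subst hl; simp
    · simp [hl, ← hconj l, Matrix.mul_assoc]
  have hlast : tucker (fun k => ((H X).U k).transpose) (tucker (B 0) Z) =
      tucker (fun k => Matrix.diagonal ((H X).weight g k)) (Pi.single i 1) := by
    rw [tucker_tucker, tucker_tucker]
    congr 1
    funext k
    exact hconj k
  rw [hfd, tucker_add, tucker_finsetSum, hlast]
  simp only [hk, Pi.add_apply, Finset.sum_apply, tucker_update_diagonal, tucker_diagonal,
    Pi.single_eq_same, mul_one]
  congr 1
  refine Finset.sum_congr rfl fun k _ => ?_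
  congr 1
  rw [← Finset.add_sum_erase Finset.univ _ (Finset.mem_univ (i k))]
  congr 1
  · rw [hdiag k, (show fderiv ℝ (fun Y => (H Y).weight g k (i k)) X Z = _ from
      (fderiv_weight hX k (hg k) i).2), Function.update_eq_self]
    simp only [HOSVD.weight]
    ring
  · refine Finset.sum_congr rfl fun c hc => ?_
    have hci := (Finset.mem_erase.1 hc).1
    have hne : (H X).σ k (i k) ^ 2 - (H X).σ k c ^ 2 ≠ 0 :=
      sub_ne_zero.2 fun h => hci (hX.sq_injective k h).symm
    have h1 := hoff k (i k) c
    -- As c ≠ i_k, one of the two symmetrized entries vanishes; the other supplies a second factor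
    -- of the same core entry, hence the square.
    rw [unfold_single_gram, unfold_single_gram, if_pos rfl, if_neg hci, add_zero] at h1
    rw [eq_div_of_mul_eq hne h1]
    ring

theorem divergence_estimator (hX : (H X).Regular)
    (hg : ∀ k, DifferentiableAt ℝ (g k) ((H X).σ k)) :
    divergence (estimator H g) X =
      (H X).divergenceFormula g (fun k => jacobian (g k) ((H X).σ k)) := by
  rw [divergence_eq_sum_conj (H X).orthogonal]
  simp only [conj_fderiv_estimator_apply hX hg]
  set h := H X
  set w := h.weight g
  set J : ModeMatrices p := fun k => jacobian (g k) (h.σ k)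
  have hP : ∀ (i : ∀ k, Fin (p k)) k, (∏ l ∈ Finset.univ.erase k, w l (i l)) * w k (i k) =
      ∏ l, w l (i l) := fun i k => by
    rw [mul_comm]
    exact Finset.mul_prod_erase Finset.univ (fun l => w l (i l)) (Finset.mem_univ k)
  have hPu : ∀ (i : ∀ k, Fin (p k)) k (m : Fin (p k)), ∏ l ∈ Finset.univ.erase k, w l (Function.update i k m l) =
      ∏ l ∈ Finset.univ.erase k, w l (i l) := fun i k m =>
    Finset.prod_congr rfl fun l hl =>
      congrArg (w l) (Function.update_of_ne (Finset.mem_erase.1 hl).1 _ _)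
  have hQ : ∀ k i, tucker (h.Q g J k) (fun j => h.S j ^ 2) i =
      (∏ l ∈ Finset.univ.erase k, w l (i l)) *
        (J k (i k) (i k) * (h.σ k (i k) ^ 2)⁻¹ * h.S i ^ 2) := by
    intro k i
    have h1 : h.Q g J k = Function.update (fun l => Matrix.diagonal (w l)) k
        (Matrix.diagonal fun a => J k a a * (h.σ k a ^ 2)⁻¹) := by
      simp only [HOSVD.Q, hX.inv_D, HOSVD.f, Matrix.diagonal_mul_diagonal, Matrix.diagonal_pow]
      congr 2
      funext a
      simp [Matrix.diag]
    rw [h1, tucker_update_diagonal, Finset.sum_eq_single (i k)]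
    · rw [Matrix.diagonal_apply_eq, Function.update_eq_self]
    · intro c _ hc
      rw [Matrix.diagonal_apply_ne _ (Ne.symm hc), zero_mul]
    · simp
  have hC : ∀ i, tucker (h.f g) (tucker (fun k => (h.D k)⁻¹) h.C) i = (∏ l, w l (i l)) * h.C i := by
    intro i
    simp only [tucker_tucker, hX.inv_D, HOSVD.f, Matrix.diagonal_mul_diagonal]
    rw [tucker_diagonal]; rfl
  simp only [HOSVD.divergenceFormula, Pi.add_apply, Finset.sum_apply, hQ, hC]
  -- The terms carrying w at the foreign index c become, after exchanging i_k and c, terms carrying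
  -- the full weight product at i; this produces the sum over m in C.
  have hswap : ∀ k, ∑ i : ∀ k, Fin (p k), ∑ c ∈ Finset.univ.erase (i k),
      (∏ l ∈ Finset.univ.erase k, w l (i l)) * (w k c /
        (h.σ k (i k) ^ 2 - h.σ k c ^ 2) * h.S (Function.update i k c) ^ 2) =
      ∑ i : ∀ k, Fin (p k), (∏ l, w l (i l)) * (h.S i ^ 2 *
        ∑ m ∈ Finset.univ.erase (i k), 1 / (h.σ k m ^ 2 - h.σ k (i k) ^ 2)) := by
    intro k
    rw [sum_update_swap k]
    refine Finset.sum_congr rfl fun i _ => ?_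
    rw [Finset.mul_sum, Finset.mul_sum]
    refine Finset.sum_congr rfl fun m _ => ?_
    rw [hPu, Function.update_self, Function.update_idem, Function.update_eq_self, ← hP i k]
    ring
  have hL : ∀ i : ∀ k, Fin (p k), ∀ k, (∏ l ∈ Finset.univ.erase k, w l (i l)) *
      ((J k (i k) (i k) - w k (i k)) * (h.σ k (i k) ^ 2)⁻¹ * h.S i ^ 2 +
        ∑ c ∈ Finset.univ.erase (i k), (w k (i k) - w k c) /
          (h.σ k (i k) ^ 2 - h.σ k c ^ 2) * h.S (Function.update i k c) ^ 2) =
      (∏ l ∈ Finset.univ.erase k, w l (i l)) *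
        (J k (i k) (i k) * (h.σ k (i k) ^ 2)⁻¹ * h.S i ^ 2) +
      (∏ l, w l (i l)) * (∑ c ∈ Finset.univ.erase (i k), h.S (Function.update i k c) ^ 2 /
          (h.σ k (i k) ^ 2 - h.σ k c ^ 2) - h.S i ^ 2 * (1 / h.σ k (i k) ^ 2)) -
      ∑ c ∈ Finset.univ.erase (i k), (∏ l ∈ Finset.univ.erase k, w l (i l)) * (w k c /
        (h.σ k (i k) ^ 2 - h.σ k c ^ 2) * h.S (Function.update i k c) ^ 2) := by
    intro i k
    have h1 : ∑ c ∈ Finset.univ.erase (i k), (w k (i k) - w k c) /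
          (h.σ k (i k) ^ 2 - h.σ k c ^ 2) * h.S (Function.update i k c) ^ 2 =
        w k (i k) * ∑ c ∈ Finset.univ.erase (i k), h.S (Function.update i k c) ^ 2 /
          (h.σ k (i k) ^ 2 - h.σ k c ^ 2) - ∑ c ∈ Finset.univ.erase (i k), w k c /
          (h.σ k (i k) ^ 2 - h.σ k c ^ 2) * h.S (Function.update i k c) ^ 2 := by
      rw [Finset.mul_sum, ← Finset.sum_sub_distrib]
      exact Finset.sum_congr rfl fun c _ => by ring
    rw [h1, ← Finset.mul_sum, ← hP i k]
    ring
  have hL' : ∀ i : ∀ k, Fin (p k), ∑ k, (∏ l ∈ Finset.univ.erase k, w l (i l)) *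
      ((J k (i k) (i k) - w k (i k)) * (h.σ k (i k) ^ 2)⁻¹ * h.S i ^ 2 +
        ∑ c ∈ Finset.univ.erase (i k), (w k (i k) - w k c) /
          (h.σ k (i k) ^ 2 - h.σ k c ^ 2) * h.S (Function.update i k c) ^ 2) +
      ∏ k, w k (i k) = _ := fun i => congrArg (· + ∏ k, w k (i k))
        (Finset.sum_congr rfl fun k _ => hL i k)
  refine (Finset.sum_congr rfl fun i _ => hL' i).trans ?_
  simp only [Finset.sum_add_distrib, Finset.sum_sub_distrib]
  have hsw := Finset.sum_congr (rfl : (Finset.univ : Finset (Fin K)) = _) fun k _ => hswap k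
  rw [Finset.sum_comm, Finset.sum_comm (γ := Fin K) (s := Finset.univ)] at hsw
  rw [hsw, ← Finset.sum_add_distrib, ← Finset.sum_sub_distrib, ← Finset.sum_add_distrib,
    ← Finset.sum_add_distrib]
  refine Finset.sum_congr rfl fun i _ => ?_
  simp only [HOSVD.C, mul_add, mul_sub, Finset.mul_sum, Finset.sum_add_distrib,
    Finset.sum_sub_distrib]
  ring

end DivergenceFormula

/-! ### The weak form -/

section WeakForm

variable {K : ℕ} {p : Fin K → ℕ} {H : ∀ X : Tensor p, HOSVD X} {X : Tensor p}
  {g : ∀ k, (Fin (p k) → ℝ) → (Fin (p k) → ℝ)}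

theorem fderiv_σ_apply' (hX : (H X).Regular) (k : Fin K) (Z : Tensor p) (a : Fin (p k)) :
    fderiv ℝ (fun Y => (H Y).σ k) X Z a = fderiv ℝ (fun Y => (H Y).σ k a) X Z := by
  have := ((hasFDerivAt_pi'.1
    ((contDiffAt_σ hX k).differentiableAt one_ne_zero).hasFDerivAt) a).fderiv
  rw [this]; rfl

/-- The singular values of a mode form a submersion on the regular set. -/
theorem surjective_fderiv_σ (hX : (H X).Regular) (k : Fin K) :
    Function.Surjective (fderiv ℝ (fun Y => (H Y).σ k) X) := by
  intro y
  -- Rescale the core slices: orthogonality of the slices makes the variation of σ_a equal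
  -- (y_a/σ_a)·σ_a²/σ_a = y_a.
  refine ⟨tucker (H X).U fun i => y (i k) / (H X).σ k (i k) * (H X).S i, ?_⟩
  funext a
  rw [fderiv_σ_apply' hX, fderiv_σ_apply hX]
  have h1 : unfold k (fun i => y (i k) / (H X).σ k (i k) * (H X).S i) =
      Matrix.diagonal (fun a => y a / (H X).σ k a) * unfold k (H X).S := by
    ext b r
    rw [Matrix.diagonal_mul]
    simp [unfold]
  have hne := ((hX k).1 a).ne'
  rw [h1, Matrix.mul_assoc, (H X).gram_S, Matrix.diagonal_mul_diagonal, Matrix.diagonal_apply_eq]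
  field_simp

/-- The first order expansion of `g` at `x` with Jacobian matrix `A`. -/
def affineJet {ι : Type*} [Fintype ι] (g : (ι → ℝ) → ι → ℝ) (A : Matrix ι ι ℝ) (x : ι → ℝ) :
    (ι → ℝ) → ι → ℝ :=
  fun y => g x + A.mulVec (y - x)

section AffineJet

variable {ι : Type*} [Fintype ι] [DecidableEq ι] (u : (ι → ℝ) → ι → ℝ) (A : Matrix ι ι ℝ)
  (x : ι → ℝ)

omit [DecidableEq ι] in
theorem affineJet_self : affineJet u A x x = u x := by simp [affineJet]

theorem hasFDerivAt_affineJet : HasFDerivAt (affineJet u A x)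
    (LinearMap.toContinuousLinearMap (Matrix.toLin' A)) x := by
  have h1 : affineJet u A x = fun y => u x +
      LinearMap.toContinuousLinearMap (Matrix.toLin' A) (y - x) := by
    funext y; simp [affineJet]
  rw [h1]
  have h2 : HasFDerivAt (fun y => y - x) (ContinuousLinearMap.id ℝ (ι → ℝ)) x :=
    (hasFDerivAt_id x).sub_const x
  have h3 := HasFDerivAt.comp (f := fun y => y - x) x
    ((LinearMap.toContinuousLinearMap (Matrix.toLin' A)).hasFDerivAt) h2
  exact h3.const_add (u x)

theorem jacobian_affineJet : jacobian (affineJet u A x) x = A := by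
  ext i j
  rw [jacobian, Matrix.of_apply, (hasFDerivAt_affineJet u A x).fderiv]
  simp

end AffineJet

/-- The weak Jacobian matrix of the estimator: the Jacobian matrix of the estimator obtained from
the first order expansions of the spectral functions. -/
def weakJacobian (H : ∀ X : Tensor p, HOSVD X) (g : ∀ k, (Fin (p k) → ℝ) → (Fin (p k) → ℝ))
    (J : ∀ k, (Fin (p k) → ℝ) → Matrix (Fin (p k)) (Fin (p k)) ℝ) (X : Tensor p) :
    Matrix (∀ k, Fin (p k)) (∀ k, Fin (p k)) ℝ :=
  jacobian (estimator H fun k => affineJet (g k) (J k ((H X).σ k)) ((H X).σ k)) X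

variable {J : ∀ k, (Fin (p k) → ℝ) → Matrix (Fin (p k)) (Fin (p k)) ℝ}

/-- The divergence formula sees g only through its value and Jacobian at s_k(X), and the first order
expansion there has value g and Jacobian J. -/
theorem trace_weakJacobian (hX : (H X).Regular) :
    (weakJacobian H g J X).trace = (H X).divergenceFormula g (fun k => J k ((H X).σ k)) := by
  have h1 := divergence_estimator hX (g := fun k => affineJet (g k) (J k ((H X).σ k)) ((H X).σ k))
    fun k => (hasFDerivAt_affineJet _ _ _).differentiableAt
  simp only [jacobian_affineJet] at h1
  refine h1.trans ?_
  have hf : (H X).f (fun k => affineJet (g k) (J k ((H X).σ k)) ((H X).σ k)) = (H X).f g := by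
    funext k
    simp only [HOSVD.f, affineJet_self]
  simp only [HOSVD.divergenceFormula, HOSVD.Q, hf]

/-- Chain and product rule on the sum representation, with the expansion point frozen at X. This is
the expression that integration by parts must produce. -/
theorem weakJacobian_apply (hX : (H X).Regular) (i j : ∀ k, Fin (p k)) :
    weakJacobian H g J X i j = ∑ a : ∀ k, Fin (p k),
      ((∑ k, ∑ b, (J k ((H X).σ k) (a k) b *
          ∏ l ∈ Finset.univ.erase k, g l ((H X).σ l) (a l)) *
          fderiv ℝ (fun Y => (H Y).σ k) X (Pi.single j 1) b) * (H X).component a i +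
        (∏ k, g k ((H X).σ k) (a k)) *
          fderiv ℝ (fun Y => (H Y).component a i) X (Pi.single j 1)) := by
  set G : ∀ k, (Fin (p k) → ℝ) → (Fin (p k) → ℝ) :=
    fun k => affineJet (g k) (J k ((H X).σ k)) ((H X).σ k)
  have hG : ∀ k, HasFDerivAt (G k) _ ((H X).σ k) := fun k => hasFDerivAt_affineJet _ _ _
  have hG0 : ∀ k, G k ((H X).σ k) = g k ((H X).σ k) := fun k => affineJet_self _ _ _
  have hσ : ∀ k, DifferentiableAt ℝ (fun Y => (H Y).σ k) X := fun k =>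
    (contDiffAt_σ hX k).differentiableAt one_ne_zero
  have hu : ∀ (a : ∀ k, Fin (p k)) k, HasFDerivAt (fun s => G k s (a k)) _ ((H X).σ k) :=
    fun a k => hasFDerivAt_pi'.1 (hG k) (a k)
  have hub : ∀ (a : ∀ k, Fin (p k)) k b, fderiv ℝ (fun s => G k s (a k)) ((H X).σ k)
      (Pi.single b 1) = J k ((H X).σ k) (a k) b := fun a k b => by
    rw [(hu a k).fderiv]; simp
  have hprod := fun a : ∀ k, Fin (p k) => fderiv_prod_comp_apply
    (s := fun k Y => (H Y).σ k) (u := fun k s => G k s (a k)) hσ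
    (fun k => (hu a k).differentiableAt) (Pi.single j 1)
  have hsum := HasFDerivAt.fun_sum (u := Finset.univ) fun (a : ∀ k, Fin (p k)) _ =>
    (hprod a).1.hasFDerivAt.fun_mul
      ((contDiffAt_component hX a i).differentiableAt one_ne_zero).hasFDerivAt
  have hest := hsum.congr_of_eventuallyEq (f₁ := fun Y => estimator H G Y i) (by
    filter_upwards [eventually_regular hX] with Y hY
    exact estimator_eq_sum hY G i)
  have hd := hasFDerivAt_pi'.1 (differentiableAt_estimator hX (g := G)
    fun k => (hG k).differentiableAt).hasFDerivAt i
  have h1 : weakJacobian H g J X i j =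
      ((ContinuousLinearMap.proj i).comp (fderiv ℝ (estimator H G) X)) (Pi.single j 1) := rfl
  rw [h1, hd.unique hest, _root_.sum_apply]
  refine Finset.sum_congr rfl fun a _ => ?_
  simp only [_root_.add_apply, _root_.smul_apply, smul_eq_mul, (hprod a).2, hub, hG0]
  ring

theorem continuousOn_fderiv_apply {f : Tensor p → ℝ} {s : Set (Tensor p)}
    (hf : ∀ x ∈ s, ContDiffAt ℝ 1 f x) (v : Tensor p) :
    ContinuousOn (fun x => fderiv ℝ f x v) s := fun x hx =>
  ((((hf x hx).fderiv_right (m := 0) (by norm_num)).continuousAt).clm_apply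
    continuousAt_const).continuousWithinAt

/-- Each coefficient is moved into the test function, leaving pure products ∏ g^k(s_k) for the weak
chain rule. -/
theorem hasWeakJacobianOn_estimator
    (hgJ : ∀ k, HasWeakJacobianOn (g k) (J k) {s | ∀ a, 0 < s a})
    (hint : ∀ i : ∀ k, Fin (p k),
      LocallyIntegrableOn (fun X => ∏ k, g k ((H X).σ k) (i k)) {X | (H X).Regular} volume)
    (hint' : ∀ (i : ∀ k, Fin (p k)) (k : Fin K) (b : Fin (p k)),
      LocallyIntegrableOn (fun X => J k ((H X).σ k) (i k) b *
        ∏ l ∈ Finset.univ.erase k, g l ((H X).σ l) (i l)) {X | (H X).Regular} volume) :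
    HasWeakJacobianOn (estimator H g) (weakJacobian H g J) {X | (H X).Regular} := by
  set R := {X | (H X).Regular}
  have hRc : IsLocallyClosed R := isOpen_regular.isLocallyClosed
  have hcomp : ∀ a i : ∀ k, Fin (p k), ContinuousOn (fun X => (H X).component a i) R :=
    fun a i X hX => (contDiffAt_component hX a i).continuousAt.continuousWithinAt
  have hcomp' : ∀ (a i : ∀ k, Fin (p k)) (v : Tensor p),
      ContinuousOn (fun X => fderiv ℝ (fun Y => (H Y).component a i) X v) R :=
    fun a i v => continuousOn_fderiv_apply (fun X hX => contDiffAt_component hX a i) v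
  have hσ' : ∀ k (v : Tensor p) b,
      ContinuousOn (fun X => fderiv ℝ (fun Y => (H Y).σ k) X v b) R := fun k v b =>
    (continuousOn_fderiv_apply (fun X hX => contDiffAt_σ_apply hX k b) v).congr
      fun X hX => fderiv_σ_apply' hX k v b
  have hGi : ∀ (a i j : ∀ k, Fin (p k)) (C : Set (Tensor p)), C ⊆ R → IsCompact C →
      IntegrableOn (fun X => (∑ k, ∑ b, (J k ((H X).σ k) (a k) b *
          ∏ l ∈ Finset.univ.erase k, g l ((H X).σ l) (a l)) *
          fderiv ℝ (fun Y => (H Y).σ k) X (Pi.single j 1) b) * (H X).component a i +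
        (∏ k, g k ((H X).σ k) (a k)) *
          fderiv ℝ (fun Y => (H Y).component a i) X (Pi.single j 1)) C := by
    intro a i j C hCR hC
    refine IntegrableOn.add (IntegrableOn.mul_continuousOn ?_ ((hcomp a i).mono hCR) hC)
      (((hint a).integrableOn_compact_subset hCR hC).mul_continuousOn
        ((hcomp' a i _).mono hCR) hC)
    exact integrable_finsetSum _ fun k _ => integrable_finsetSum _ fun b _ =>
      ((hint' a k b).integrableOn_compact_subset hCR hC).mul_continuousOn
        ((hσ' k _ b).mono hCR) hC
  refine ⟨fun i => ?_, fun i j => ?_, fun i j φ hφ hφc hφR => ?_⟩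
  · refine (locallyIntegrableOn_iff hRc).2 fun C hCR hC => ?_
    refine IntegrableOn.congr_fun (integrable_finsetSum Finset.univ fun a _ =>
      ((hint a).integrableOn_compact_subset hCR hC).mul_continuousOn ((hcomp a i).mono hCR) hC)
      (fun X hX => (estimator_eq_sum (hCR hX) g i).symm) hC.measurableSet
  · refine (locallyIntegrableOn_iff hRc).2 fun C hCR hC => ?_
    exact IntegrableOn.congr_fun (integrable_finsetSum Finset.univ fun a _ => hGi a i j C hCR hC)
      (fun X hX => (weakJacobian_apply (hCR hX) i j).symm) hC.measurableSet
  · set v : Tensor p := Pi.single j 1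
    set C := tsupport φ
    have hC : IsCompact C := hφc
    have hφ1 : ContDiff ℝ 1 φ := hφ.of_le (by exact_mod_cast le_top)
    have hφ0 : ∀ X, X ∉ C → φ X = 0 := fun X hX => image_eq_zero_of_notMem_tsupport hX
    have hφ0' : ∀ X, X ∉ C → fderiv ℝ φ X v = 0 := fun X hX => by
      rw [fderiv_of_notMem_tsupport ℝ hX]; rfl
    -- These are only C¹, which is why the weak chain rule is stated for C¹ test functions.
    let ψ : (∀ k, Fin (p k)) → Tensor p → ℝ := fun a X => (H X).component a i * φ X
    have hψsub : ∀ a, tsupport (ψ a) ⊆ C := fun a => tsupport_mul_subset_right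
    have hψ : ∀ a, ContDiff ℝ 1 (ψ a) := fun a => contDiff_iff_contDiffAt.2 fun X => by
      by_cases hX : X ∈ C
      · exact (contDiffAt_component (hφR hX) a i).mul hφ1.contDiffAt
      · refine (contDiffAt_const (c := (0 : ℝ))).congr_of_eventuallyEq ?_
        filter_upwards [(isClosed_tsupport φ).isOpen_compl.mem_nhds hX] with Y hY
        simp only [ψ, hφ0 Y hY, mul_zero]
    have hψc : ∀ a, HasCompactSupport (ψ a) := fun a => hφc.mul_left
    have hψd : ∀ a, ∀ X ∈ C, fderiv ℝ (ψ a) X v = (H X).component a i * fderiv ℝ φ X v +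
        φ X * fderiv ℝ (fun Y => (H Y).component a i) X v := fun a X hX => by
      have := ((((contDiffAt_component (hφR hX) a i).differentiableAt one_ne_zero).hasFDerivAt).fun_mul
        (hφ1.differentiable one_ne_zero X).hasFDerivAt).fderiv
      rw [show fderiv ℝ (ψ a) X = _ from this]
      rfl
    have hψ0 : ∀ a X, X ∉ C → ψ a X = 0 := fun a X hX => by simp only [ψ, hφ0 X hX, mul_zero]
    have hψ0' : ∀ a X, X ∉ C → fderiv ℝ (ψ a) X v = 0 := fun a X hX => by
      rw [fderiv_of_notMem_tsupport ℝ fun h => hX (hψsub a h)]; rfl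
    have key := fun a : ∀ k, Fin (p k) => integral_weak_prod_comp_mul_fderiv
      (volume : Measure (Tensor p)) (s := fun k X => (H X).σ k) (Ω := R)
      (V := fun k => {s : Fin (p k) → ℝ | ∀ a, 0 < s a}) (h := fun k s => g k s (a k))
      (J := fun k s b => J k s (a k) b) (ψ := ψ a)
      (fun k X hX => contDiffAt_σ hX k) (fun k X hX => surjective_fderiv_σ hX k)
      (fun k => by
        simp only [ofPred_forall]
        exact isOpen_iInter_of_finite fun a => isOpen_lt continuous_const (continuous_apply a))
      (fun k X hX => (hX k).1) (fun k => (hgJ k).locallyIntegrable (a k))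
      (fun k b => (hgJ k).locallyIntegrable_jacobian (a k) b)
      (fun k b φ => (hgJ k).integral_eq (a k) b φ)
      (hint a) (fun k b => hint' a k b) (hψ a) (hψc a) ((hψsub a).trans hφR) v
    have hFi : ∀ a : ∀ k, Fin (p k), IntegrableOn (fun X => ∏ k, g k ((H X).σ k) (a k)) C := fun a =>
      (hint a).integrableOn_compact_subset hφR hC
    have hFψ : ∀ a : ∀ k, Fin (p k), IntegrableOn (fun X => (∏ k, g k ((H X).σ k) (a k)) * fderiv ℝ (ψ a) X v) C :=
      fun a => (hFi a).mul_continuousOn (((hψ a).continuous_fderiv one_ne_zero).clm_apply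
        continuous_const).continuousOn hC
    have hFc : ∀ a : ∀ k, Fin (p k), IntegrableOn (fun X => (∏ k, g k ((H X).σ k) (a k)) *
        (φ X * fderiv ℝ (fun Y => (H Y).component a i) X v)) C := fun a =>
      (hFi a).mul_continuousOn (hφ1.continuous.continuousOn.mul ((hcomp' a i v).mono hφR)) hC
    have hJi : ∀ (a : ∀ k, Fin (p k)) k b, IntegrableOn (fun X => (J k ((H X).σ k) (a k) b *
        ∏ l ∈ Finset.univ.erase k, g l ((H X).σ l) (a l)) *
        (fderiv ℝ (fun Y => (H Y).σ k) X v b * ψ a X)) C := fun a k b =>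
      ((hint' a k b).integrableOn_compact_subset hφR hC).mul_continuousOn
        (((hσ' k v b).mono hφR).mul (hψ a).continuous.continuousOn) hC
    have hkeyC : ∀ a : ∀ k, Fin (p k),
        ∫ X in C, (∏ k, g k ((H X).σ k) (a k)) * fderiv ℝ (ψ a) X v =
        - ∫ X in C, ∑ k, ∑ b, (J k ((H X).σ k) (a k) b *
          ∏ l ∈ Finset.univ.erase k, g l ((H X).σ l) (a l)) *
          (fderiv ℝ (fun Y => (H Y).σ k) X v b * ψ a X) := fun a => by
      have h1 := key a
      rw [integral_eq_setIntegral_tsupport volume φ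
        (fun X hX => by rw [hψ0' a X hX, mul_zero])] at h1
      rw [h1, integral_finsetSum _ fun k _ => integrable_finsetSum _ fun b _ => hJi a k b]
      congr 1
      refine Finset.sum_congr rfl fun k _ => ?_
      rw [integral_finsetSum _ fun b _ => hJi a k b]
      exact Finset.sum_congr rfl fun b _ => integral_eq_setIntegral_tsupport volume φ
        fun X hX => by rw [hψ0 a X hX, mul_zero, mul_zero]
    rw [integral_eq_setIntegral_tsupport volume φ (fun X hX => by rw [hφ0' X hX, mul_zero]),
      integral_eq_setIntegral_tsupport volume φ (fun X hX => by rw [hφ0 X hX, mul_zero])]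
    -- Uses component · φ' = ψ' − φ · component'; the subtracted part reappears as the coefficient
    -- derivative in the weak Jacobian.
    have hleft : ∫ X in C, estimator H g X i * fderiv ℝ φ X v = ∑ a : ∀ k, Fin (p k),
        ((∫ X in C, (∏ k, g k ((H X).σ k) (a k)) * fderiv ℝ (ψ a) X v) -
          ∫ X in C, (∏ k, g k ((H X).σ k) (a k)) *
            (φ X * fderiv ℝ (fun Y => (H Y).component a i) X v)) := by
      rw [Finset.sum_congr rfl fun a _ => (integral_sub (hFψ a) (hFc a)).symm]
      refine Eq.trans ?_ (integral_finsetSum _ fun a _ => (hFψ a).sub (hFc a))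
      refine setIntegral_congr_fun hC.measurableSet fun X hX => ?_
      simp only [estimator_eq_sum (hφR hX) g i, Finset.sum_mul]
      refine Finset.sum_congr rfl fun a _ => ?_
      rw [hψd a X hX]; ring
    have hright : ∫ X in C, weakJacobian H g J X i j * φ X = ∑ a : ∀ k, Fin (p k),
        ((∫ X in C, ∑ k, ∑ b, (J k ((H X).σ k) (a k) b *
          ∏ l ∈ Finset.univ.erase k, g l ((H X).σ l) (a l)) *
          (fderiv ℝ (fun Y => (H Y).σ k) X v b * ψ a X)) +
          ∫ X in C, (∏ k, g k ((H X).σ k) (a k)) *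
            (φ X * fderiv ℝ (fun Y => (H Y).component a i) X v)) := by
      have hJi' := fun a => integrable_finsetSum (μ := volume.restrict C) Finset.univ fun k _ =>
        integrable_finsetSum Finset.univ fun b _ => hJi a k b
      rw [Finset.sum_congr rfl fun a _ => (integral_add (hJi' a) (hFc a)).symm]
      refine Eq.trans ?_ (integral_finsetSum _ fun a _ => (hJi' a).add (hFc a))
      refine setIntegral_congr_fun hC.measurableSet fun X hX => ?_
      simp only [weakJacobian_apply (hφR hX) i j, Finset.sum_mul]
      refine Finset.sum_congr rfl fun a _ => ?_
      rw [add_mul, Finset.sum_mul]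
      congr 1
      · refine Finset.sum_congr rfl fun k _ => ?_
        rw [Finset.sum_mul]
        exact Finset.sum_congr rfl fun b _ => by simp only [ψ]; ring
      · ring
    rw [hleft, hright, ← Finset.sum_neg_distrib]
    refine Finset.sum_congr rfl fun a _ => ?_
    rw [hkeyC a]; ring

end WeakForm

end HOSpectral

end

/-! ### The two forms together -/

theorem mainTheorem4 {K : ℕ} {p : Fin K → ℕ}
    (H : ∀ X : HOSpectral.Tensor p, HOSpectral.HOSVD X)
    (g : ∀ k, (Fin (p k) → ℝ) → (Fin (p k) → ℝ)) :
    (∀ X : HOSpectral.Tensor p, (H X).Regular →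
      (∀ k, DifferentiableAt ℝ (g k) ((H X).σ k)) →
      DifferentiableAt ℝ (HOSpectral.estimator H g) X ∧
      HOSpectral.divergence (HOSpectral.estimator H g) X =
        (H X).divergenceFormula g (fun k => HOSpectral.jacobian (g k) ((H X).σ k))) ∧
    (∀ J : ∀ k, (Fin (p k) → ℝ) → Matrix (Fin (p k)) (Fin (p k)) ℝ,
      (∀ k, HOSpectral.HasWeakJacobianOn (g k) (J k) {s | ∀ a, 0 < s a}) →
      (∀ i : ∀ k, Fin (p k),
        LocallyIntegrableOn (fun X => ∏ k, g k ((H X).σ k) (i k))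
          {X | (H X).Regular} volume) →
      (∀ (i : ∀ k, Fin (p k)) (k : Fin K) (b : Fin (p k)),
        LocallyIntegrableOn (fun X => J k ((H X).σ k) (i k) b *
            ∏ l ∈ Finset.univ.erase k, g l ((H X).σ l) (i l))
          {X | (H X).Regular} volume) →
      ∃ G : HOSpectral.Tensor p → Matrix (∀ k, Fin (p k)) (∀ k, Fin (p k)) ℝ,
        HOSpectral.HasWeakJacobianOn (HOSpectral.estimator H g) G {X | (H X).Regular} ∧
        ∀ᵐ X ∂(volume.restrict {X | (H X).Regular}),
          (G X).trace = (H X).divergenceFormula g (fun k => J k ((H X).σ k))) := by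
  refine ⟨fun X hX hg => ⟨HOSpectral.differentiableAt_estimator hX hg,
    HOSpectral.divergence_estimator hX hg⟩, fun J hJ h1 h2 =>
    ⟨HOSpectral.weakJacobian H g J, HOSpectral.hasWeakJacobianOn_estimator hJ h1 h2, ?_⟩⟩
  -- The trace identity holds at every regular point for this weak Jacobian; measurability of the
  -- set comes from its openness.
  exact ae_restrict_of_forall_mem HOSpectral.isOpen_regular.measurableSet
    fun X hX => HOSpectral.trace_weakJacobian hX
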